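/- Let $P_1,P_2,N>0$. All rate pairs $(R_1,R_2)$ are nonnegative and $\log$ is the natural logarithm (rates in nats). \emph{Ozarow's rectangle.} For $\rho\in[0,1]$ let $\mathcal R_{\mathrm{Oz}}^{\rho}(P_1,P_2,N)$ be the set of rate pairs with $R_\nu\le\frac12\log\bigl(1+\frac{P_\nu(1-\rho^2)}{N}\bigr)$, $\nu=1,2$, and $R_1+R_2\le\frac12\log\bigl(1+\frac{P_1+P_2+2\sqrt{P_1P_2}\,\rho}{N}\bigr)$. Let $\rho^*$ be the unique solution in $[0,1]$ of $N(N+P_1+P_2+2\sqrt{P_1P_2}\,\rho)=(N+P_1(1-\rho^2))(N+P_2(1-\rho^2))$, and let $R^*=\bigl(\frac12\log(1+\frac{P_1(1-\rho^{*2})}{N}),\ \frac12\log(1+\frac{P_2(1-\rho^{*2})}{N})\bigr)$. \emph{The region $\mathcal R(P_1,P_2,N,K)$.} Let $K$ be a positive semidefinite real $2\times2$ matrix. For an integer $\eta\ge1$, vectors $a_1,a_2\in\mathbb R^\eta$, strictly lower-triangular $B_1,B_2\in\mathbb R^{\eta\times\eta}$ and $C\in\mathbb R^{2\times\eta}$ put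 $$A=(a_1\ a_2),\quad A_d=\begin{pmatrix}a_1&0\\0&a_2\end{pmatrix},\quad \bar B=(B_1\ B_2),\quad B_t=\begin{pmatrix}B_1\\B_2\end{pmatrix},\quad B_d=\begin{pmatrix}B_1&0\\0&B_2\end{pmatrix},\quad \mathbf B=\begin{pmatrix}B_1&B_1\\B_2&B_2\end{pmatrix},$$ $S=NI_\eta+\bar B(K\otimes I_\eta)\bar B^{T}$. If $CC^{T}$ is nonsingular, the region of $(\eta,a_1,a_2,B_1,B_2,C)$ is the set of rate pairs with $$R_\nu\le\frac1{2\eta}\log\frac{|C(a_\nu a_\nu^{T}+S)C^{T}|}{|CSC^{T}|}\ (\nu=1,2),\qquad R_1+R_2\le\frac1{2\eta}\log\frac{|C(AA^{T}+S)C^{T}|}{|CSC^{T}|};$$ if $CC^{T}$ is singular and $C\ne0$, $C$ is replaced here by one of its nonzero rows; if $C=0$ the region is $\{(0,0)\}$. Then $\mathcal R(P_1,P_2,N,K)$ is the closure of the union of these regions over all $(\eta,a_1,a_2,B_1,B_2,C)$ for which the two $\eta\times\eta$ diagonal blocks of $$(I_{2\eta}-\mathbf B)^{-1}\bigl(A_dA_d^{T}+N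 B_tB_t^{T}+B_d(K\otimes I_\eta)B_d^{T}\bigr)(I_{2\eta}-\mathbf B)^{-T}$$ have traces at most $\eta P_1$ and $\eta P_2$, respectively. \emph{Perfect-feedback capacity region.} Consider the channel $Y_t=X_{1,t}+X_{2,t}+Z_t$ with $Z_t$ i.i.d. $\mathcal N(0,N)$, where $X_{\nu,t}$ is a (measurable) function of the message $M_\nu$ and of $Y_1,\dots,Y_{t-1}$, the messages are independent of each other and of the noise and uniform on finite sets $\mathcal M_1,\mathcal M_2$, $\frac1n\sum_{t=1}^n\mathbb E[X_{\nu,t}^2]\le P_\nu$, and the receiver decodes $(M_1,M_2)$ from $Y_1,\dots,Y_n$. $\mathcal C_{\mathrm{PerfectFB}}(P_1,P_2,N)$ is the set of $(R_1,R_2)$ such that for every $\delta>0$ there are, for all sufficiently large $n$, codes of blocklength $n$ with $\frac1n\log|\mathcal M_\nu|>R_\nu-\delta$, $\nu=1,2$, whose average error probability tends to $0$ as $n\to\infty$. \textbf{Statement.} With $K$ ranging over positive semidefinite real $2\times 2$ matrices, $$\mathrm{cl}\Bigl(\ \bigcup_{\sigma>0}\ \bigcap_{K:\ \mathrm{tr}K\le\sigma^2}\mathcal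 R(P_1,P_2,N,K)\Bigr)\ \supseteq\ \mathcal R_{\mathrm{Oz}}^{\rho^*}(P_1,P_2,N).$$ Consequently the regions $\mathcal R(P_1,P_2,N,K)$ approach the point of maximum sum-rate of $\mathcal C_{\mathrm{PerfectFB}}(P_1,P_2,N)$ as the feedback-noise variances vanish, irrespective of the feedback-noise correlation: $R^*$ is the unique point of maximum sum-rate $R_1+R_2$ in $\mathcal C_{\mathrm{PerfectFB}}(P_1,P_2,N)$, and for every $\varepsilon>0$ there is $\sigma>0$ such that for every $K\succeq0$ with $\mathrm{tr}K\le\sigma^2$ the region $\mathcal R(P_1,P_2,N,K)$ contains a point at distance less than $\varepsilon$ from $R^*$. -/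

import Mathlib

open scoped Kronecker

noncomputable section

namespace AWGNMAC

/-! ### Ozarow's regions -/

/-- The quartic equation whose unique root in `[0,1]` is `ρ*`. -/
def RhoEquation (P₁ P₂ N ρ : ℝ) : Prop :=
  N * (N + P₁ + P₂ + 2 * √(P₁ * P₂) * ρ) =
    (N + P₁ * (1 - ρ ^ 2)) * (N + P₂ * (1 - ρ ^ 2))

/-- For positive parameters the quartic equation has exactly one solution in `[0,1]`. -/
theorem existsUnique_rhoEquation {P₁ P₂ N : ℝ} (h₁ : 0 < P₁) (h₂ : 0 < P₂) (hN : 0 < N) :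
    ∃! ρ : ℝ, ρ ∈ Set.Icc (0 : ℝ) 1 ∧ RhoEquation P₁ P₂ N ρ := by
  have hs : 0 < √(P₁ * P₂) := Real.sqrt_pos.2 (mul_pos h₁ h₂)
  have hmono : ∀ x y : ℝ, 0 ≤ x → x < y → y ≤ 1 →
      RhoEquation P₁ P₂ N x → RhoEquation P₁ P₂ N y → False := by
    intro x y hx hxy hy ex ey
    unfold RhoEquation at ex ey
    have hl : N * (N + P₁ + P₂ + 2 * √(P₁ * P₂) * x) <
        N * (N + P₁ + P₂ + 2 * √(P₁ * P₂) * y) := by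
      have : √(P₁ * P₂) * x < √(P₁ * P₂) * y := by gcongr
      exact mul_lt_mul_of_pos_left (by linarith) hN
    have hsq : x ^ 2 ≤ y ^ 2 := by gcongr
    have hy2 : 0 ≤ 1 - y ^ 2 := by nlinarith
    have hr : (N + P₁ * (1 - y ^ 2)) * (N + P₂ * (1 - y ^ 2)) ≤
        (N + P₁ * (1 - x ^ 2)) * (N + P₂ * (1 - x ^ 2)) := by
      have hx2 : 0 ≤ 1 - x ^ 2 := by linarith
      gcongr
    linarith
  let g : ℝ → ℝ := fun ρ => (N + P₁ * (1 - ρ ^ 2)) * (N + P₂ * (1 - ρ ^ 2)) -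
    N * (N + P₁ + P₂ + 2 * √(P₁ * P₂) * ρ)
  have hg : ContinuousOn g (Set.Icc 0 1) := by
    apply Continuous.continuousOn
    fun_prop
  have h0 : (0 : ℝ) ∈ Set.Icc (g 1) (g 0) := by
    constructor
    · simp only [g]; nlinarith [mul_pos hN h₁, mul_pos hN h₂, mul_pos hN hs]
    · simp only [g]; nlinarith [mul_pos h₁ h₂]
  obtain ⟨ρ, hρ, hρ0⟩ := intermediate_value_Icc' zero_le_one hg h0
  refine ⟨ρ, ⟨hρ, ?_⟩, ?_⟩
  · simp only [g] at hρ0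
    unfold RhoEquation
    linarith
  · rintro y ⟨hy, ey⟩
    have ex : RhoEquation P₁ P₂ N ρ := by
      simp only [g] at hρ0
      unfold RhoEquation
      linarith
    rcases lt_trichotomy y ρ with h | h | h
    · exact (hmono y ρ hy.1 h hρ.2 ey ex).elim
    · exact h
    · exact (hmono ρ y hρ.1 h hy.2 ex ey).elim

open Classical in
/-- `ρ*(P₁,P₂,N)`: the unique solution in `[0,1]` of the quartic equation
(which exists for positive parameters; a dummy value otherwise). -/
def rhoStar (P₁ P₂ N : ℝ) : ℝ :=
  if h : ∃! ρ : ℝ, ρ ∈ Set.Icc (0 : ℝ) 1 ∧ RhoEquation P₁ P₂ N ρ then h.choose else 0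

theorem rhoStar_spec {P₁ P₂ N : ℝ} (h₁ : 0 < P₁) (h₂ : 0 < P₂) (hN : 0 < N) :
    rhoStar P₁ P₂ N ∈ Set.Icc (0 : ℝ) 1 ∧ RhoEquation P₁ P₂ N (rhoStar P₁ P₂ N) := by
  have h := existsUnique_rhoEquation h₁ h₂ hN
  unfold rhoStar
  rw [dif_pos h]
  exact h.choose_spec.1

/-- Ozarow's region `R_Oz^ρ(P₁,P₂,N)`. -/
def ozarowRegion (P₁ P₂ N ρ : ℝ) : Set (ℝ × ℝ) :=
  {R | 0 ≤ R.1 ∧ 0 ≤ R.2 ∧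
    R.1 ≤ 1 / 2 * Real.log (1 + P₁ * (1 - ρ ^ 2) / N) ∧
    R.2 ≤ 1 / 2 * Real.log (1 + P₂ * (1 - ρ ^ 2) / N) ∧
    R.1 + R.2 ≤ 1 / 2 * Real.log (1 + (P₁ + P₂ + 2 * √(P₁ * P₂) * ρ) / N)}

/-- The dominant corner point of the rectangle `R_Oz^{ρ*}(P₁,P₂,N)`. -/
def ozarowCorner (P₁ P₂ N : ℝ) : ℝ × ℝ :=
  (1 / 2 * Real.log (1 + P₁ * (1 - rhoStar P₁ P₂ N ^ 2) / N),
    1 / 2 * Real.log (1 + P₂ * (1 - rhoStar P₁ P₂ N ^ 2) / N))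

/-! ### The regions of the concatenated scheme

The two transmitters are indexed by `Fin 2`; a vector of length `2η` is indexed by
`Fin 2 × Fin η` (transmitter first), so that block matrices are indexed in the same way as the
Kronecker product `K ⊗ₖ I_η`. -/

section Concatenated

variable {η : ℕ}

/-- The `η × 2` matrix `(a₁ a₂)`. -/
def aRow (a : Fin 2 → Fin η → ℝ) : Matrix (Fin η) (Fin 2) ℝ :=
  Matrix.of fun i ν => a ν i

/-- The `2η × 2` block-diagonal matrix with diagonal blocks `a₁`, `a₂`. -/
def aDiag (a : Fin 2 → Fin η → ℝ) : Matrix (Fin 2 × Fin η) (Fin 2) ℝ :=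
  Matrix.of fun p ν => if p.1 = ν then a ν p.2 else 0

/-- The `η × 2η` matrix `(B₁ B₂)`. -/
def bRow (B : Fin 2 → Matrix (Fin η) (Fin η) ℝ) : Matrix (Fin η) (Fin 2 × Fin η) ℝ :=
  Matrix.of fun i q => B q.1 i q.2

/-- The `2η × η` matrix with `B₁` on top of `B₂`. -/
def bCol (B : Fin 2 → Matrix (Fin η) (Fin η) ℝ) : Matrix (Fin 2 × Fin η) (Fin η) ℝ :=
  Matrix.of fun p j => B p.1 p.2 j

/-- The `2η × 2η` block-diagonal matrix with diagonal blocks `B₁`, `B₂`. -/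
def bDiag (B : Fin 2 → Matrix (Fin η) (Fin η) ℝ) :
    Matrix (Fin 2 × Fin η) (Fin 2 × Fin η) ℝ :=
  Matrix.of fun p q => if p.1 = q.1 then B p.1 p.2 q.2 else 0

/-- The `2η × 2η` matrix with block rows `(B₁ B₁)` and `(B₂ B₂)`. -/
def bFull (B : Fin 2 → Matrix (Fin η) (Fin η) ℝ) :
    Matrix (Fin 2 × Fin η) (Fin 2 × Fin η) ℝ :=
  Matrix.of fun p q => B p.1 p.2 q.2

/-- The effective noise covariance `N I_η + (B₁ B₂)(K ⊗ I_η)(B₁ B₂)ᵀ`. -/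
def noiseCov (N : ℝ) (K : Matrix (Fin 2) (Fin 2) ℝ) (B : Fin 2 → Matrix (Fin η) (Fin η) ℝ) :
    Matrix (Fin η) (Fin η) ℝ :=
  N • (1 : Matrix (Fin η) (Fin η) ℝ) +
    bRow B * (K ⊗ₖ (1 : Matrix (Fin η) (Fin η) ℝ)) * (bRow B).transpose

/-- `(1/(2η)) log (|C (S + T) Cᵀ| / |C T Cᵀ|)`, with signal covariance `S` and
noise covariance `T`. -/
def logDetRate {ι : Type} [Fintype ι] [DecidableEq ι] (C : Matrix ι (Fin η) ℝ)
    (S T : Matrix (Fin η) (Fin η) ℝ) : ℝ :=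
  1 / (2 * (η : ℝ)) *
    Real.log ((C * (S + T) * C.transpose).det / (C * T * C.transpose).det)

/-- The nonnegative rate pairs that satisfy the three rate constraints for a decoding
matrix `C` (with two rows or with one row). -/
def rateSet {ι : Type} [Fintype ι] [DecidableEq ι] (N : ℝ) (K : Matrix (Fin 2) (Fin 2) ℝ)
    (a : Fin 2 → Fin η → ℝ) (B : Fin 2 → Matrix (Fin η) (Fin η) ℝ)
    (C : Matrix ι (Fin η) ℝ) : Set (ℝ × ℝ) :=
  {R | 0 ≤ R.1 ∧ 0 ≤ R.2 ∧
    R.1 ≤ logDetRate C (Matrix.vecMulVec (a 0) (a 0)) (noiseCov N K B) ∧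
    R.2 ≤ logDetRate C (Matrix.vecMulVec (a 1) (a 1)) (noiseCov N K B) ∧
    R.1 + R.2 ≤ logDetRate C (aRow a * (aRow a).transpose) (noiseCov N K B)}

/-- The region `R(N, K; η, a₁, a₂, B₁, B₂, C)`. If `C Cᵀ` is singular and `C ≠ 0`, then `C` is
replaced by one of its nonzero rows (these are proportional, so all choices agree); if `C = 0`
the region is the origin. -/
def schemeRegion (N : ℝ) (K : Matrix (Fin 2) (Fin 2) ℝ)
    (a : Fin 2 → Fin η → ℝ) (B : Fin 2 → Matrix (Fin η) (Fin η) ℝ)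
    (C : Matrix (Fin 2) (Fin η) ℝ) : Set (ℝ × ℝ) :=
  {R | (IsUnit (C * C.transpose).det ∧ R ∈ rateSet N K a B C) ∨
    (¬ IsUnit (C * C.transpose).det ∧
      ∃ i : Fin 2, C i ≠ 0 ∧ R ∈ rateSet N K a B (Matrix.replicateRow (Fin 1) (C i))) ∨
    (C = 0 ∧ R = 0)}

/-- The second-moment matrix of the `2η` channel inputs of one block,
`(I - B)⁻¹ (A Aᵀ + N B̃ B̃ᵀ + D (K ⊗ I) Dᵀ) (I - B)⁻ᵀ`. -/
def inputCov (N : ℝ) (K : Matrix (Fin 2) (Fin 2) ℝ)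
    (a : Fin 2 → Fin η → ℝ) (B : Fin 2 → Matrix (Fin η) (Fin η) ℝ) :
    Matrix (Fin 2 × Fin η) (Fin 2 × Fin η) ℝ :=
  (1 - bFull B)⁻¹ *
    (aDiag a * (aDiag a).transpose + N • (bCol B * (bCol B).transpose) +
      bDiag B * (K ⊗ₖ (1 : Matrix (Fin η) (Fin η) ℝ)) * (bDiag B).transpose) *
    ((1 - bFull B)⁻¹).transpose

/-- The trace of the diagonal block of the input covariance that belongs to transmitter `ν`. -/
def inputPower (N : ℝ) (K : Matrix (Fin 2) (Fin 2) ℝ)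
    (a : Fin 2 → Fin η → ℝ) (B : Fin 2 → Matrix (Fin η) (Fin η) ℝ) (ν : Fin 2) : ℝ :=
  ((inputCov N K a B).submatrix (fun i => (ν, i)) (fun i => (ν, i))).trace

end Concatenated

/-- The rate region `R(P₁,P₂,N,K)` of the concatenated scheme. -/
def rateRegion (P₁ P₂ N : ℝ) (K : Matrix (Fin 2) (Fin 2) ℝ) : Set (ℝ × ℝ) :=
  closure {R | ∃ (η : ℕ) (a : Fin 2 → Fin η → ℝ) (B : Fin 2 → Matrix (Fin η) (Fin η) ℝ)
    (C : Matrix (Fin 2) (Fin η) ℝ),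
    0 < η ∧
    (∀ (ν : Fin 2) (i j : Fin η), i ≤ j → B ν i j = 0) ∧
    inputPower N K a B 0 ≤ (η : ℝ) * P₁ ∧
    inputPower N K a B 1 ≤ (η : ℝ) * P₂ ∧
    R ∈ schemeRegion N K a B C}

/-- The set `⋃_{σ > 0} ⋂_{K : tr K ≤ σ²} R(P₁,P₂,N,K)`; `K` ranges over covariance
matrices. -/
def vanishingNoiseRegion (P₁ P₂ N : ℝ) : Set (ℝ × ℝ) :=
  ⋃ σ ∈ Set.Ioi (0 : ℝ),
    ⋂ K ∈ {K : Matrix (Fin 2) (Fin 2) ℝ | K.PosSemidef ∧ K.trace ≤ σ ^ 2},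
      rateRegion P₁ P₂ N K

/-! ### The capacity region of the AWGN MAC with perfect feedback -/

/-- The encoders and the decoder of a blocklength-`n` code for the two-user MAC with perfect
feedback. At time `t` (counted from `0`) each encoder sees its message and the `t` previous
channel outputs. -/
structure FeedbackCode (n : ℕ) where
  /-- number of messages of transmitter 1 -/
  M₁ : ℕ
  /-- number of messages of transmitter 2 -/
  M₂ : ℕ
  enc₁ : (t : Fin n) → Fin M₁ → (Fin t → ℝ) → ℝ
  enc₂ : (t : Fin n) → Fin M₂ → (Fin t → ℝ) → ℝ
  dec : (Fin n → ℝ) → Fin M₁ × Fin M₂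
  measurable_enc₁ : ∀ t m, Measurable (enc₁ t m)
  measurable_enc₂ : ∀ t m, Measurable (enc₂ t m)
  measurable_dec : Measurable dec

namespace FeedbackCode

variable {n : ℕ}

/-- The first `t` channel outputs when the messages are `m₁`, `m₂` and the noise is `z`:
`Y_s = X_{1,s} + X_{2,s} + z_s`. -/
def output (c : FeedbackCode n) (m₁ : Fin c.M₁) (m₂ : Fin c.M₂) (z : Fin n → ℝ) :
    (t : ℕ) → t ≤ n → Fin t → ℝ
  | 0, _ => Fin.elim0
  | t + 1, h =>
    Fin.snoc (α := fun _ => ℝ) (c.output m₁ m₂ z t (Nat.le_of_succ_le h))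
      (c.enc₁ ⟨t, h⟩ m₁ (c.output m₁ m₂ z t (Nat.le_of_succ_le h)) +
        c.enc₂ ⟨t, h⟩ m₂ (c.output m₁ m₂ z t (Nat.le_of_succ_le h)) + z ⟨t, h⟩)

/-- The time-`t` channel input of transmitter 1. -/
def input₁ (c : FeedbackCode n) (m₁ : Fin c.M₁) (m₂ : Fin c.M₂) (z : Fin n → ℝ)
    (t : Fin n) : ℝ :=
  c.enc₁ t m₁ (c.output m₁ m₂ z t t.isLt.le)

/-- The time-`t` channel input of transmitter 2. -/
def input₂ (c : FeedbackCode n) (m₁ : Fin c.M₁) (m₂ : Fin c.M₂) (z : Fin n → ℝ)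
    (t : Fin n) : ℝ :=
  c.enc₂ t m₂ (c.output m₁ m₂ z t t.isLt.le)

end FeedbackCode

/-- The law of `n` i.i.d. centred Gaussians of variance `N`. -/
def noiseLaw (n : ℕ) (N : ℝ) : MeasureTheory.Measure (Fin n → ℝ) :=
  MeasureTheory.Measure.pi fun _ => ProbabilityTheory.gaussianReal 0 N.toNNReal

namespace FeedbackCode

variable {n : ℕ}

/-- The average block-power constraint `(1/n) ∑ₜ E[Xₜ²] ≤ P` on channel inputs `X`; the
expectation is over independent uniform messages and the noise. -/
def PowerConstraint (c : FeedbackCode n) (N P : ℝ)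
    (X : Fin c.M₁ → Fin c.M₂ → (Fin n → ℝ) → Fin n → ℝ) : Prop :=
  (∀ m₁ m₂ t, MeasureTheory.Integrable (fun z => X m₁ m₂ z t ^ 2) (noiseLaw n N)) ∧
  1 / (n : ℝ) * ∑ t, (1 / ((c.M₁ : ℝ) * c.M₂) *
    ∑ m₁, ∑ m₂, ∫ z, X m₁ m₂ z t ^ 2 ∂(noiseLaw n N)) ≤ P

/-- The average probability of a decoding error. -/
def errorProb (c : FeedbackCode n) (N : ℝ) : ℝ :=
  1 / ((c.M₁ : ℝ) * c.M₂) * ∑ m₁, ∑ m₂,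
    (noiseLaw n N).real {z | c.dec (c.output m₁ m₂ z n le_rfl) ≠ (m₁, m₂)}

end FeedbackCode

/-- The capacity region of the AWGN MAC with perfect feedback: the set of all achievable
(nonnegative) rate pairs, in nats per channel use. -/
def perfectFeedbackCapacity (P₁ P₂ N : ℝ) : Set (ℝ × ℝ) :=
  {R | 0 ≤ R.1 ∧ 0 ≤ R.2 ∧ ∀ δ > (0 : ℝ), ∀ ε > (0 : ℝ), ∀ᶠ n : ℕ in Filter.atTop,
    ∃ c : FeedbackCode n,
      c.PowerConstraint N P₁ c.input₁ ∧ c.PowerConstraint N P₂ c.input₂ ∧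
      R.1 - δ < 1 / (n : ℝ) * Real.log c.M₁ ∧ R.2 - δ < 1 / (n : ℝ) * Real.log c.M₂ ∧
      c.errorProb N ≤ ε}

end AWGNMAC

end

/-!
In Ozarow's scheme each user repeatedly sends the amplified error of the linear MMSE estimate of
its message. At `ρ*` one step multiplies the precision of user `ν` by `1 + P_ν (1 - ρ*²) / N` and
merely flips the sign of the error correlation, so the information matrix of the scheme stays
explicit: with precisions `J₀` and `J₁` its determinant is `(1 - ρ*²) J₀ J₁`. After a fixed number
of idle slots the power constraints hold strictly, and so do the rate constraints at any point
below the corner once the block is long. As the constraints are continuous in `K` and the entries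
of `K ⪰ 0` are bounded by `tr K`, they survive all small feedback noises, whatever the correlation.

The corner is achieved by sending PAM points through the same linear scheme: after zero forcing,
the error of user `ν` has variance of order `exp (-2 n R*_ν)`, while the points are
`2 exp (-n (R*_ν - δ))` apart, so Chebyshev's inequality suffices.

For the converse, the law of the outputs is compared with a Gaussian law under which the innovation
is `α X₁ + β X₂ + Z` instead of `Z`. The message of user `1` is invisible in the conditional mean
of that law if `α = 1`, that of user `2` if `β = 1`. Taking the other coefficient from the linear
regression of one input on the other bounds the individual rates, `α = β = 1` bounds the sum-rate,
and this is Ozarow's outer bound, with `ρ` the empirical correlation of the inputs; compactness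
makes `ρ` independent of the blocklength. The individual bounds decrease in `ρ`, the bound on the
sum-rate increases, and they meet at `ρ*`.
-/

noncomputable section

namespace AWGNMAC

open Filter Finset Matrix Topology MeasureTheory ProbabilityTheory
open scoped ENNReal

/-! ### Ozarow's correlation coefficient -/

/-- The factor `1 + p (1 - ρ²) / N` by which, in Ozarow's scheme, one channel use divides the
error variance of a user of power `p`. -/
def gain (N ρ p : ℝ) : ℝ := 1 + p * (1 - ρ ^ 2) / N

theorem one_sub_sq_pos {ρ : ℝ} (hρ : ρ ∈ Set.Ioo (0 : ℝ) 1) : 0 < 1 - ρ ^ 2 := by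
  nlinarith [hρ.1, hρ.2]

theorem one_lt_gain {N ρ p : ℝ} (hN : 0 < N) (hρ : ρ ∈ Set.Ioo (0 : ℝ) 1) (hp : 0 < p) :
    1 < gain N ρ p := by
  have := one_sub_sq_pos hρ
  exact lt_add_of_pos_right 1 (by positivity)

theorem gain_pos {N ρ p : ℝ} (hN : 0 < N) (hρ : ρ ∈ Set.Ioo (0 : ℝ) 1) (hp : 0 < p) :
    0 < gain N ρ p :=
  zero_lt_one.trans (one_lt_gain hN hρ hp)

namespace RhoEquation

variable {P₁ P₂ N ρ : ℝ}

theorem mem_Ioo (h : RhoEquation P₁ P₂ N ρ) (h₁ : 0 < P₁) (h₂ : 0 < P₂) (hN : 0 < N)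
    (hρ : ρ ∈ Set.Icc (0 : ℝ) 1) : ρ ∈ Set.Ioo (0 : ℝ) 1 := by
  have hs : 0 < √(P₁ * P₂) := Real.sqrt_pos.2 (mul_pos h₁ h₂)
  unfold RhoEquation at h
  constructor
  · refine lt_of_le_of_ne hρ.1 ?_
    rintro rfl
    nlinarith [mul_pos h₁ h₂]
  · refine lt_of_le_of_ne hρ.2 ?_
    rintro rfl
    nlinarith [mul_pos hN h₁, mul_pos hN h₂, mul_pos hN hs]

theorem gain_mul_gain (h : RhoEquation P₁ P₂ N ρ) (hN : N ≠ 0) :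
    gain N ρ P₁ * gain N ρ P₂ = 1 + (P₁ + P₂ + 2 * √(P₁ * P₂) * ρ) / N := by
  unfold RhoEquation at h
  unfold gain
  field_simp
  linarith

/-- At `ρ*` one step of the recursion flips the sign of the correlation and keeps its modulus. -/
theorem sqrt_mul_one_sub_sq_div (h : RhoEquation P₁ P₂ N ρ) (h₁ : 0 < P₁) (h₂ : 0 < P₂)
    (hN : 0 < N) (hρ : ρ ∈ Set.Ioo (0 : ℝ) 1) :
    √(P₁ * P₂) * (1 - ρ ^ 2) / N = ρ * (1 + √(gain N ρ P₁ * gain N ρ P₂)) := by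
  have hτ := one_sub_sq_pos hρ
  have hs : √(P₁ * P₂) ^ 2 = P₁ * P₂ := Real.sq_sqrt (mul_pos h₁ h₂).le
  have hg₁ := one_lt_gain hN hρ h₁
  have hg₂ := one_lt_gain hN hρ h₂
  have hq : √(gain N ρ P₁ * gain N ρ P₂) ^ 2 = gain N ρ P₁ * gain N ρ P₂ :=
    Real.sq_sqrt (by positivity)
  have hq1 : 1 ≤ √(gain N ρ P₁ * gain N ρ P₂) := Real.one_le_sqrt.2 (by nlinarith)
  have hsq : (√(P₁ * P₂) * (1 - ρ ^ 2) / N - ρ) ^ 2 =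
      (ρ * √(gain N ρ P₁ * gain N ρ P₂)) ^ 2 := by
    have hq' := hq.trans (h.gain_mul_gain hN.ne')
    generalize √(gain N ρ P₁ * gain N ρ P₂) = q at hq hq' ⊢
    generalize √(P₁ * P₂) = s at hs hq' ⊢
    unfold gain at hq
    field_simp at hq hq' ⊢
    linear_combination (1 - ρ ^ 2) ^ 2 * hs - hq + N * (1 - ρ ^ 2) * hq'
  have hκ : 0 < √(P₁ * P₂) * (1 - ρ ^ 2) / N := by positivity
  rcases sq_eq_sq_iff_eq_or_eq_neg.1 hsq with h' | h'
  · linarith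
  · nlinarith [hρ.1]

end RhoEquation

theorem rhoStar_mem_Ioo {P₁ P₂ N : ℝ} (h₁ : 0 < P₁) (h₂ : 0 < P₂) (hN : 0 < N) :
    rhoStar P₁ P₂ N ∈ Set.Ioo (0 : ℝ) 1 :=
  (rhoStar_spec h₁ h₂ hN).2.mem_Ioo h₁ h₂ hN (rhoStar_spec h₁ h₂ hN).1

/-! ### Linear feedback schemes -/

/-- Square matrices that vanish on and above the diagonal: the causal feedback matrices. -/
def IsStrictlyLower {η : ℕ} (F : Matrix (Fin η) (Fin η) ℝ) : Prop := ∀ i j, i ≤ j → F i j = 0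

namespace IsStrictlyLower

variable {η : ℕ} {F : Matrix (Fin η) (Fin η) ℝ}

theorem sum {ι : Type*} [Fintype ι] {F : ι → Matrix (Fin η) (Fin η) ℝ}
    (hF : ∀ ν, IsStrictlyLower (F ν)) : IsStrictlyLower (∑ ν, F ν) := fun i j hij => by
  rw [Matrix.sum_apply]
  exact Finset.sum_eq_zero fun ν _ => hF ν i j hij

theorem one_add_isLowerTriangular (hF : IsStrictlyLower F) : (1 + F).IsLowerTriangular := by
  intro i j hij
  have hij : i < j := by simpa using hij
  simp [hF i j hij.le, hij.ne]

theorem isUnit_det_one_add (hF : IsStrictlyLower F) : IsUnit (1 + F).det := by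
  rw [det_of_isLowerTriangular _ hF.one_add_isLowerTriangular]
  simp [hF _ _ le_rfl]

theorem mul_isLowerTriangular (hF : IsStrictlyLower F) {L : Matrix (Fin η) (Fin η) ℝ}
    (hL : L.IsLowerTriangular) : IsStrictlyLower (F * L) := fun i j hij => by
  rw [Matrix.mul_apply]
  refine Finset.sum_eq_zero fun k _ => ?_
  rcases le_or_gt i k with hik | hki
  · rw [hF i k hik, zero_mul]
  · rw [hL (OrderDual.toDual_lt_toDual.2 (hki.trans_le hij)), mul_zero]

end IsStrictlyLower

section LinearScheme

variable {η : ℕ} {ι : Type*} [Fintype ι]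

/-- The feedback matrices `B_ν`, acting on all past channel outputs, for which the inputs are
`a_ν ξ_ν + F_ν (A ξ + Z)` with feedback matrices `F_ν` acting on the outputs of the open loop. -/
def feedbackMatrix (F : ι → Matrix (Fin η) (Fin η) ℝ) (ν : ι) : Matrix (Fin η) (Fin η) ℝ :=
  F ν * (1 + ∑ μ, F μ)⁻¹

/-- The power of transmitter `ν` when it sends `a_ν ξ_ν + F_ν (A ξ + Z)` for uncorrelated
messages `ξ_μ` of unit variance and white noise `Z` of variance `N`. -/
def linearPower [DecidableEq ι] (N : ℝ) (a : ι → Fin η → ℝ) (F : ι → Matrix (Fin η) (Fin η) ℝ)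
    (ν : ι) : ℝ :=
  ∑ t, (∑ μ, ((if ν = μ then a μ t else 0) + (F ν *ᵥ a μ) t) ^ 2 + N * ∑ s, F ν t s ^ 2)

variable {F : ι → Matrix (Fin η) (Fin η) ℝ}

theorem feedbackMatrix_mul_one_add_sum (hF : ∀ ν, IsStrictlyLower (F ν)) (ν : ι) :
    feedbackMatrix F ν * (1 + ∑ μ, F μ) = F ν := by
  rw [feedbackMatrix, Matrix.mul_assoc,
    nonsing_inv_mul _ (IsStrictlyLower.sum hF).isUnit_det_one_add, Matrix.mul_one]

theorem isStrictlyLower_feedbackMatrix (hF : ∀ ν, IsStrictlyLower (F ν)) (ν : ι) :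
    IsStrictlyLower (feedbackMatrix F ν) := by
  have hS := IsStrictlyLower.sum hF
  have := ((1 + ∑ μ, F μ).isUnit_iff_isUnit_det.2 hS.isUnit_det_one_add).invertible
  exact (hF ν).mul_isLowerTriangular
    (blockTriangular_inv_of_blockTriangular hS.one_add_isLowerTriangular)

end LinearScheme

section InputPower

variable {η : ℕ} {F : Fin 2 → Matrix (Fin η) (Fin η) ℝ}

theorem bFull_mul_bFull (B F : Fin 2 → Matrix (Fin η) (Fin η) ℝ) :
    bFull B * bFull F = bFull fun ν => B ν * ∑ μ, F μ := by
  ext ⟨μ, i⟩ ⟨κ, j⟩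
  simp [bFull, Matrix.mul_apply, Fintype.sum_prod_type, Fin.sum_univ_two, mul_add,
    sum_add_distrib]

theorem bFull_mul_bCol (B F : Fin 2 → Matrix (Fin η) (Fin η) ℝ) :
    bFull B * bCol F = bCol fun ν => B ν * ∑ μ, F μ := by
  ext ⟨μ, i⟩ j
  simp [bFull, bCol, Matrix.mul_apply, Fintype.sum_prod_type, Fin.sum_univ_two, mul_add,
    sum_add_distrib]

theorem one_sub_bFull_mul_one_add_bFull (hF : ∀ ν, IsStrictlyLower (F ν)) :
    (1 - bFull (feedbackMatrix F)) * (1 + bFull F) = 1 := by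
  have hB : bFull (feedbackMatrix F) + (bFull fun ν => feedbackMatrix F ν * ∑ μ, F μ) =
      bFull F := by
    ext ⟨ν, i⟩ ⟨κ, j⟩
    simpa [Matrix.mul_add, bFull] using congrFun₂ (feedbackMatrix_mul_one_add_sum hF ν) i j
  rw [Matrix.sub_mul, Matrix.one_mul, Matrix.mul_add, Matrix.mul_one, bFull_mul_bFull, hB,
    add_sub_cancel_right]

theorem one_add_bFull_mul_bCol (hF : ∀ ν, IsStrictlyLower (F ν)) :
    (1 + bFull F) * bCol (feedbackMatrix F) = bCol F := by
  have hcol : (1 - bFull (feedbackMatrix F)) * bCol F = bCol (feedbackMatrix F) := by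
    rw [Matrix.sub_mul, Matrix.one_mul, bFull_mul_bCol, sub_eq_iff_eq_add]
    ext ⟨ν, i⟩ j
    simpa [Matrix.mul_add, bCol] using
      (congrFun₂ (feedbackMatrix_mul_one_add_sum hF ν) i j).symm
  rw [← hcol, ← Matrix.mul_assoc,
    mul_eq_one_comm.1 (one_sub_bFull_mul_one_add_bFull hF), Matrix.one_mul]

theorem one_add_bFull_mul_aDiag_apply (F : Fin 2 → Matrix (Fin η) (Fin η) ℝ)
    (a : Fin 2 → Fin η → ℝ) (ν μ : Fin 2) (t : Fin η) :
    ((1 + bFull F) * aDiag a : Matrix (Fin 2 × Fin η) (Fin 2) ℝ) (ν, t) μ =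
      (if ν = μ then a μ t else 0) + (F ν *ᵥ a μ) t := by
  rw [Matrix.add_mul, Matrix.one_mul]
  simp only [Matrix.add_apply, aDiag, Matrix.of_apply, Matrix.mul_apply, bFull,
    Fintype.sum_prod_type, Fin.sum_univ_two, mulVec, dotProduct]
  congr 1
  fin_cases μ <;> simp

theorem inputPower_feedbackMatrix (N : ℝ) (a : Fin 2 → Fin η → ℝ)
    (hF : ∀ ν, IsStrictlyLower (F ν)) (ν : Fin 2) :
    inputPower N 0 a (feedbackMatrix F) ν = linearPower N a F ν := by
  have hcov : inputCov N 0 a (feedbackMatrix F) =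
      ((1 + bFull F) * aDiag a) * ((1 + bFull F) * aDiag a)ᵀ + N • (bCol F * (bCol F)ᵀ) := by
    rw [inputCov, inv_eq_right_inv (one_sub_bFull_mul_one_add_bFull hF),
      ← one_add_bFull_mul_bCol hF]
    simp only [zero_kronecker, Matrix.mul_zero, Matrix.zero_mul, add_zero, transpose_mul,
      Matrix.mul_add ((1 + bFull F)), Matrix.add_mul _ _ (1 + bFull F)ᵀ, Matrix.mul_smul,
      Matrix.smul_mul, Matrix.mul_assoc]
  rw [inputPower, hcov, linearPower, Matrix.trace]
  refine Finset.sum_congr rfl fun t _ => ?_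
  rw [diag_apply, submatrix_apply, Matrix.add_apply, Matrix.smul_apply, Matrix.mul_apply,
    Matrix.mul_apply]
  simp only [transpose_apply, one_add_bFull_mul_aDiag_apply, sq]
  rfl

end InputPower

/-! ### Feedback of linear MMSE estimates -/

section MMSE

/-- The initial segment of length `η` of a family of amplitude sequences. -/
def initialBlock {ι : Type*} (η : ℕ) (a : ι → ℕ → ℝ) (ν : ι) (t : Fin η) : ℝ := a ν t

variable {ι : Type*} [DecidableEq ι]

/-- The information matrix `I + (∑_{s<t} a_s a_sᵀ) / N`, whose inverse is the error covariance of
the linear MMSE estimate of unit-variance messages from `∑_μ a_{μ,s} ξ_μ + Z_s`, `s < t`. -/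
def information (N : ℝ) (a : ι → ℕ → ℝ) (t : ℕ) : Matrix ι ι ℝ :=
  1 + N⁻¹ • ∑ s ∈ range t, vecMulVec (a · s) (a · s)

theorem information_apply (N : ℝ) (a : ι → ℕ → ℝ) (t : ℕ) (μ κ : ι) :
    information N a t μ κ =
      (1 : Matrix ι ι ℝ) μ κ + (∑ s ∈ range t, a μ s * a κ s) / N := by
  simp [information, Matrix.sum_apply, vecMulVec_apply, div_eq_inv_mul]

theorem information_zero (N : ℝ) (a : ι → ℕ → ℝ) : information N a 0 = 1 := by
  simp [information]

theorem information_succ_apply (N : ℝ) (a : ι → ℕ → ℝ) (t : ℕ) (μ κ : ι) :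
    information N a (t + 1) μ κ = information N a t μ κ + a μ t * a κ t / N := by
  rw [information_apply, information_apply, sum_range_succ]
  ring

theorem information_apply_comm (N : ℝ) (a : ι → ℕ → ℝ) (t : ℕ) (μ κ : ι) :
    information N a t μ κ = information N a t κ μ := by
  simp only [information_apply, mul_comm (a μ _), Matrix.one_apply, eq_comm]

variable [Fintype ι]

/-- The feedback matrices for which transmitter `ν` sends at time `t` the multiple `a_ν(t)` of the
error of the linear MMSE estimate of its message from the past. -/
def mmseFeedback (N : ℝ) (a : ι → ℕ → ℝ) (η : ℕ) (ν : ι) : Matrix (Fin η) (Fin η) ℝ :=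
  Matrix.of fun t s =>
    if s < t then -(a ν t / N) * ((information N a t)⁻¹ *ᵥ (a · s)) ν else 0

variable {N : ℝ} {a : ι → ℕ → ℝ} {η : ℕ}

theorem isStrictlyLower_mmseFeedback (N : ℝ) (a : ι → ℕ → ℝ) (η : ℕ) (ν : ι) :
    IsStrictlyLower (mmseFeedback N a η ν) := fun i j hij => by
  simp [mmseFeedback, hij.not_gt]

theorem sum_fin_ite_lt {M : Type*} [AddCommMonoid M] (f : ℕ → M) (t : Fin η) :
    (∑ s : Fin η, if s < t then f s else 0) = ∑ s ∈ range t, f s := by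
  simp only [Fin.lt_def]
  rw [Fin.sum_univ_eq_sum_range (fun s => if s < (t : ℕ) then f s else 0), ← sum_filter]
  congr 1
  ext s
  simp only [mem_filter, mem_range]
  omega

theorem inv_information_mul_gram (hN : N ≠ 0) {t : ℕ} (hdet : (information N a t).det ≠ 0) :
    (information N a t)⁻¹ * ∑ s ∈ range t, vecMulVec (a · s) (a · s) =
      N • (1 - (information N a t)⁻¹) := by
  have hgram : ∑ s ∈ range t, vecMulVec (a · s) (a · s) = N • (information N a t - 1) := by
    simp [information, smul_smul, hN]
  rw [hgram, Matrix.mul_smul, Matrix.mul_sub, nonsing_inv_mul _ (isUnit_iff_ne_zero.2 hdet),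
    Matrix.mul_one]

theorem mmseFeedback_mulVec (hN : N ≠ 0) {t : Fin η} (hdet : (information N a t).det ≠ 0)
    (ν μ : ι) : (mmseFeedback N a η ν *ᵥ initialBlock η a μ) t =
      a ν t * ((information N a t)⁻¹ - 1) ν μ := by
  have hrow : (mmseFeedback N a η ν *ᵥ initialBlock η a μ) t = -(a ν t / N) *
      ((information N a t)⁻¹ * ∑ s ∈ range t, vecMulVec (a · s) (a · s)) ν μ := by
    change ∑ s, mmseFeedback N a η ν t s * a μ s = _
    simp only [mmseFeedback, of_apply, ite_mul, zero_mul]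
    rw [sum_fin_ite_lt (fun s => -(a ν t / N) * ((information N a t)⁻¹ *ᵥ (a · s)) ν * a μ s),
      Matrix.mul_sum, Matrix.sum_apply, mul_sum]
    simp only [mul_vecMulVec, vecMulVec_apply, mul_assoc]
  rw [hrow, inv_information_mul_gram hN hdet]
  simp only [Matrix.smul_apply, Matrix.sub_apply, smul_eq_mul]
  field_simp
  ring

theorem mul_sum_mmseFeedback_sq (hN : N ≠ 0) {t : Fin η} (hdet : (information N a t).det ≠ 0)
    (ν : ι) : N * ∑ s, mmseFeedback N a η ν t s ^ 2 = a ν t ^ 2 *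
      ((information N a t)⁻¹ ν ν - ∑ μ, (information N a t)⁻¹ ν μ ^ 2) := by
  have hsum : ∑ s, mmseFeedback N a η ν t s ^ 2 = (a ν t / N) ^ 2 *
      ((information N a t)⁻¹ * (∑ s ∈ range t, vecMulVec (a · s) (a · s)) *
        ((information N a t)⁻¹)ᵀ) ν ν := by
    simp only [mmseFeedback, of_apply, ite_pow, zero_pow two_ne_zero]
    rw [sum_fin_ite_lt (fun s => (-(a ν t / N) * ((information N a t)⁻¹ *ᵥ (a · s)) ν) ^ 2),
      Matrix.mul_sum, Matrix.sum_mul, Matrix.sum_apply, mul_sum]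
    simp only [mul_vecMulVec, vecMulVec_mul, vecMul_transpose, vecMulVec_apply, mul_pow, neg_sq,
      sq (((information N a t)⁻¹ *ᵥ _) ν)]
  rw [hsum, inv_information_mul_gram hN hdet, Matrix.smul_mul, Matrix.sub_mul, Matrix.one_mul]
  simp only [Matrix.smul_apply, Matrix.sub_apply, transpose_apply, smul_eq_mul,
    Matrix.mul_apply, ← sq]
  field_simp

/-- The errors of the estimates have covariance `(information N a t)⁻¹`. -/
theorem linearPower_mmseFeedback (hN : N ≠ 0)
    (hdet : ∀ t : Fin η, (information N a t).det ≠ 0) (ν : ι) :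
    linearPower N (initialBlock η a) (mmseFeedback N a η) ν =
      ∑ t ∈ range η, a ν t ^ 2 * (information N a t)⁻¹ ν ν := by
  rw [← Fin.sum_univ_eq_sum_range (fun t => a ν t ^ 2 * (information N a t)⁻¹ ν ν)]
  refine Finset.sum_congr rfl fun t _ => ?_
  have hinput : ∀ μ, ((if ν = μ then initialBlock η a μ t else 0) +
      (mmseFeedback N a η ν *ᵥ initialBlock η a μ) t) = a ν t * (information N a t)⁻¹ ν μ := by
    intro μ
    rw [mmseFeedback_mulVec hN (hdet t), Matrix.sub_apply, Matrix.one_apply]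
    split_ifs with h
    · subst h
      simp only [initialBlock]
      ring
    · ring
  simp only [hinput, mul_sum_mmseFeedback_sq hN (hdet t), mul_pow, ← mul_sum]
  ring

end MMSE

/-! ### Ozarow's scheme -/

/-- The error precision, in Ozarow's scheme, of the message of a user of power `p` after the
initial transmission and `t` further steps. -/
def precision (N ρ p : ℝ) (t : ℕ) : ℝ := gain N ρ p ^ t / (1 - ρ)

theorem precision_pos {N ρ p : ℝ} (hN : 0 < N) (hρ : ρ ∈ Set.Ioo (0 : ℝ) 1) (hp : 0 < p) (t : ℕ) :
    0 < precision N ρ p t :=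
  div_pos (pow_pos (gain_pos hN hρ hp) t) (sub_pos.2 hρ.2)

theorem tendsto_precision_atTop {N ρ p : ℝ} (hN : 0 < N) (hρ : ρ ∈ Set.Ioo (0 : ℝ) 1)
    (hp : 0 < p) : Tendsto (precision N ρ p) atTop atTop :=
  (tendsto_pow_atTop_atTop_of_one_lt (one_lt_gain hN hρ hp)).atTop_div_const (sub_pos.2 hρ.2)

/-- The amplitudes with which the users of Ozarow's scheme amplify their estimation errors. The
initial transmissions create the correlation `ρ` of the errors; the signs alternate with it, so
that afterwards the modulus of the correlation is `ρ` at all times. -/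
def ozarowAmplitude (N ρ : ℝ) (P : Fin 2 → ℝ) (ν : Fin 2) : ℕ → ℝ
  | 0 => √(N * ρ / (1 - ρ))
  | t + 1 => (-1) ^ ((ν : ℕ) * (t + 1)) * √(P ν * (1 + ρ)) * √(gain N ρ (P ν)) ^ t

section OzarowAmplitude

variable {N ρ : ℝ} {P : Fin 2 → ℝ}

theorem ozarowAmplitude_zero_sq (hN : 0 < N) (hρ : ρ ∈ Set.Ioo (0 : ℝ) 1) (ν : Fin 2) :
    ozarowAmplitude N ρ P ν 0 ^ 2 = N * ρ / (1 - ρ) :=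
  Real.sq_sqrt (div_nonneg (mul_nonneg hN.le hρ.1.le) (sub_pos.2 hρ.2).le)

theorem ozarowAmplitude_succ_sq (hN : 0 < N) (hρ : ρ ∈ Set.Ioo (0 : ℝ) 1) (hP : ∀ ν, 0 < P ν)
    (ν : Fin 2) (t : ℕ) :
    ozarowAmplitude N ρ P ν (t + 1) ^ 2 = P ν * (1 + ρ) * gain N ρ (P ν) ^ t := by
  have hρ' := hρ.1
  have hPν := hP ν
  rw [ozarowAmplitude, mul_pow, mul_pow, pow_right_comm (-1 : ℝ), neg_one_sq, one_pow, one_mul,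
    Real.sq_sqrt (by positivity), pow_right_comm √_, Real.sq_sqrt (gain_pos hN hρ hPν).le]

theorem ozarowAmplitude_succ_mul (hN : 0 < N) (hρ : ρ ∈ Set.Ioo (0 : ℝ) 1) (hP : ∀ ν, 0 < P ν)
    (t : ℕ) : ozarowAmplitude N ρ P 0 (t + 1) * ozarowAmplitude N ρ P 1 (t + 1) =
      (-1) ^ (t + 1) * (√(P 0 * P 1) * (1 + ρ)) *
        √(gain N ρ (P 0) * gain N ρ (P 1)) ^ t := by
  have hρ' : 0 < 1 + ρ := add_pos one_pos hρ.1
  have hsqrt : √(P 0 * (1 + ρ)) * √(P 1 * (1 + ρ)) = √(P 0 * P 1) * (1 + ρ) := by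
    rw [Real.sqrt_mul (hP 0).le, Real.sqrt_mul (hP 1).le, Real.sqrt_mul (hP 0).le]
    linear_combination √(P 0) * √(P 1) * Real.mul_self_sqrt hρ'.le
  rw [ozarowAmplitude, ozarowAmplitude, Real.sqrt_mul (gain_pos hN hρ (hP 0)).le, mul_pow, ← hsqrt]
  simp only [Fin.val_zero, Fin.val_one, zero_mul, one_mul, pow_zero]
  ring

theorem information_ozarowAmplitude_diag (hN : 0 < N) (hρ : ρ ∈ Set.Ioo (0 : ℝ) 1)
    (hP : ∀ ν, 0 < P ν) (ν : Fin 2) (t : ℕ) :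
    information N (ozarowAmplitude N ρ P) (t + 1) ν ν = precision N ρ (P ν) t := by
  have hρ' : 1 - ρ ≠ 0 := (sub_pos.2 hρ.2).ne'
  induction t with
  | zero =>
    rw [information_succ_apply, ← sq, ozarowAmplitude_zero_sq hN hρ, information_zero, precision,
      one_apply_eq]
    field_simp
    ring
  | succ t ih =>
    rw [information_succ_apply, ih, ← sq, ozarowAmplitude_succ_sq hN hρ hP, precision, precision,
      pow_succ]
    nth_rw 4 [gain]
    field_simp
    ring

theorem information_ozarowAmplitude_cross (hN : 0 < N) (hρ : ρ ∈ Set.Ioo (0 : ℝ) 1)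
    (hP : ∀ ν, 0 < P ν) (h : RhoEquation (P 0) (P 1) N ρ) (t : ℕ) :
    information N (ozarowAmplitude N ρ P) (t + 1) 0 1 =
      (-1) ^ t * ρ * √(gain N ρ (P 0) * gain N ρ (P 1)) ^ t / (1 - ρ) := by
  have hρ' : 1 - ρ ≠ 0 := (sub_pos.2 hρ.2).ne'
  induction t with
  | zero =>
    have h₀ := ozarowAmplitude_zero_sq (P := P) hN hρ 0
    rw [sq] at h₀
    rw [information_succ_apply, information_zero, one_apply_ne zero_ne_one]
    change 0 + ozarowAmplitude N ρ P 0 0 * ozarowAmplitude N ρ P 0 0 / N = _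
    rw [h₀]
    field_simp
    ring
  | succ t ih =>
    have hstep := h.sqrt_mul_one_sub_sq_div (hP 0) (hP 1) hN hρ
    rw [information_succ_apply, ih, ozarowAmplitude_succ_mul hN hρ hP]
    generalize √(gain N ρ (P 0) * gain N ρ (P 1)) = q at hstep ⊢
    rw [eq_div_iff hρ', add_mul, div_mul_cancel₀ _ hρ']
    linear_combination (-1) ^ (t + 1) * q ^ t * hstep

theorem information_ozarowAmplitude_cross_sq (hN : 0 < N) (hρ : ρ ∈ Set.Ioo (0 : ℝ) 1)
    (hP : ∀ ν, 0 < P ν) (h : RhoEquation (P 0) (P 1) N ρ) (t : ℕ) :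
    information N (ozarowAmplitude N ρ P) (t + 1) 0 1 ^ 2 =
      ρ ^ 2 * (precision N ρ (P 0) t * precision N ρ (P 1) t) := by
  have hg := mul_pos (gain_pos hN hρ (hP 0)) (gain_pos hN hρ (hP 1))
  rw [information_ozarowAmplitude_cross hN hρ hP h, div_pow, mul_pow, mul_pow,
    pow_right_comm (-1 : ℝ), pow_right_comm √_, Real.sq_sqrt hg.le, precision, precision,
    div_mul_div_comm, ← sq, ← mul_div_assoc, ← mul_pow, neg_one_sq, one_pow, one_mul]

theorem det_information_ozarowAmplitude (hN : 0 < N) (hρ : ρ ∈ Set.Ioo (0 : ℝ) 1)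
    (hP : ∀ ν, 0 < P ν) (h : RhoEquation (P 0) (P 1) N ρ) (t : ℕ) :
    (information N (ozarowAmplitude N ρ P) (t + 1)).det =
      (1 - ρ ^ 2) * (precision N ρ (P 0) t * precision N ρ (P 1) t) := by
  rw [det_fin_two, information_apply_comm _ _ _ 1 0, information_ozarowAmplitude_diag hN hρ hP,
    information_ozarowAmplitude_diag hN hρ hP, ← sq,
    information_ozarowAmplitude_cross_sq hN hρ hP h]
  ring

theorem det_information_ozarowAmplitude_pos (hN : 0 < N) (hρ : ρ ∈ Set.Ioo (0 : ℝ) 1)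
    (hP : ∀ ν, 0 < P ν) (h : RhoEquation (P 0) (P 1) N ρ) (t : ℕ) :
    0 < (information N (ozarowAmplitude N ρ P) t).det := by
  cases t with
  | zero => simp [information_zero]
  | succ t =>
    rw [det_information_ozarowAmplitude hN hρ hP h]
    exact mul_pos (one_sub_sq_pos hρ)
      (mul_pos (precision_pos hN hρ (hP 0) t) (precision_pos hN hρ (hP 1) t))

theorem inv_information_ozarowAmplitude_diag (hN : 0 < N) (hρ : ρ ∈ Set.Ioo (0 : ℝ) 1)
    (hP : ∀ ν, 0 < P ν) (h : RhoEquation (P 0) (P 1) N ρ) (ν : Fin 2) (t : ℕ) :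
    (information N (ozarowAmplitude N ρ P) (t + 1))⁻¹ ν ν =
      1 / ((1 - ρ ^ 2) * precision N ρ (P ν) t) := by
  have hτ := (one_sub_sq_pos hρ).ne'
  have h₀ := (precision_pos hN hρ (hP 0) t).ne'
  have h₁ := (precision_pos hN hρ (hP 1) t).ne'
  rw [Matrix.inv_def, Ring.inverse_eq_inv', Matrix.smul_apply, smul_eq_mul, adjugate_fin_two,
    det_information_ozarowAmplitude hN hρ hP h]
  fin_cases ν <;> simp [information_ozarowAmplitude_diag hN hρ hP] <;> field_simp

theorem ozarowAmplitude_succ_power (hN : 0 < N) (hρ : ρ ∈ Set.Ioo (0 : ℝ) 1)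
    (hP : ∀ ν, 0 < P ν) (h : RhoEquation (P 0) (P 1) N ρ) (ν : Fin 2) (t : ℕ) :
    ozarowAmplitude N ρ P ν (t + 1) ^ 2 *
      (information N (ozarowAmplitude N ρ P) (t + 1))⁻¹ ν ν = P ν := by
  have := (sub_pos.2 hρ.2).ne'
  have := (one_sub_sq_pos hρ).ne'
  have := (gain_pos hN hρ (hP ν)).ne'
  rw [ozarowAmplitude_succ_sq hN hρ hP, inv_information_ozarowAmplitude_diag hN hρ hP h, precision]
  field_simp
  ring

end OzarowAmplitude

/-- The amplitudes of Ozarow's scheme with `m` steps after the initial transmission, followed by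
idle slots. -/
def ozarowBlock (N ρ : ℝ) (P : Fin 2 → ℝ) (m : ℕ) (ν : Fin 2) (t : ℕ) : ℝ :=
  if t < m + 1 then ozarowAmplitude N ρ P ν t else 0

section OzarowBlock

variable {N ρ : ℝ} {P : Fin 2 → ℝ}

theorem information_ozarowBlock (N ρ : ℝ) (P : Fin 2 → ℝ) (m t : ℕ) :
    information N (ozarowBlock N ρ P m) t =
      information N (ozarowAmplitude N ρ P) (min t (m + 1)) := by
  have hfilter : (range t).filter (· < m + 1) = range (min t (m + 1)) := by
    ext s
    simp
  ext μ κ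
  simp only [information_apply, ozarowBlock, ite_mul, mul_ite, zero_mul, mul_zero, ← hfilter,
    sum_filter]
  refine congrArg (_ + · / N) (sum_congr rfl fun s _ => ?_)
  split_ifs <;> rfl

theorem linearPower_ozarowBlock (hN : 0 < N) (hρ : ρ ∈ Set.Ioo (0 : ℝ) 1) (hP : ∀ ν, 0 < P ν)
    (h : RhoEquation (P 0) (P 1) N ρ) (m k : ℕ) (ν : Fin 2) :
    linearPower N (initialBlock (m + 1 + k) (ozarowBlock N ρ P m))
      (mmseFeedback N (ozarowBlock N ρ P m) (m + 1 + k)) ν = m * P ν + N * ρ / (1 - ρ) := by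
  have hactive : ∑ t ∈ range (m + 1), ozarowBlock N ρ P m ν t ^ 2 *
      (information N (ozarowBlock N ρ P m) t)⁻¹ ν ν = m * P ν + N * ρ / (1 - ρ) := by
    have hstep : ∀ t ∈ range (m + 1), ozarowBlock N ρ P m ν t ^ 2 *
        (information N (ozarowBlock N ρ P m) t)⁻¹ ν ν = ozarowAmplitude N ρ P ν t ^ 2 *
          (information N (ozarowAmplitude N ρ P) t)⁻¹ ν ν := fun t ht => by
      have ht := mem_range.1 ht
      rw [information_ozarowBlock, min_eq_left ht.le, ozarowBlock, if_pos ht]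
    rw [sum_congr rfl hstep, sum_range_succ']
    simp [ozarowAmplitude_succ_power hN hρ hP h, information_zero, ozarowAmplitude_zero_sq hN hρ]
  have hidle : ∑ t ∈ range k, ozarowBlock N ρ P m ν (m + 1 + t) ^ 2 *
      (information N (ozarowBlock N ρ P m) (m + 1 + t))⁻¹ ν ν = 0 :=
    sum_eq_zero fun t _ => by rw [ozarowBlock, if_neg (by omega), zero_pow two_ne_zero, zero_mul]
  rw [linearPower_mmseFeedback hN.ne', sum_range_add, hactive, hidle, add_zero]
  intro t
  rw [information_ozarowBlock]
  exact (det_information_ozarowAmplitude_pos hN hρ hP h _).ne'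

/-- The idle slots make up for the power of the initial transmission. -/
theorem exists_forall_linearPower_ozarowBlock_lt (hN : 0 < N) (hρ : ρ ∈ Set.Ioo (0 : ℝ) 1)
    (hP : ∀ ν, 0 < P ν) (h : RhoEquation (P 0) (P 1) N ρ) : ∃ k : ℕ, ∀ (m : ℕ) (ν : Fin 2),
      linearPower N (initialBlock (m + 1 + k) (ozarowBlock N ρ P m))
        (mmseFeedback N (ozarowBlock N ρ P m) (m + 1 + k)) ν < ((m + 1 + k : ℕ) : ℝ) * P ν := by
  have hidle : ∀ᶠ k : ℕ in atTop, ∀ ν, N * ρ / (1 - ρ) < (k : ℝ) * P ν :=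
    eventually_all.2 fun ν =>
      (tendsto_natCast_atTop_atTop.atTop_mul_const (hP ν)).eventually_gt_atTop _
  obtain ⟨k, hk⟩ := hidle.exists
  refine ⟨k, fun m ν => ?_⟩
  rw [linearPower_ozarowBlock hN hρ hP h]
  push_cast
  linarith [hk ν, hP ν]

end OzarowBlock

/-! ### Decoding from the Gram matrix of the amplitudes -/

theorem transpose_aRow_mul_aRow {N : ℝ} (hN : N ≠ 0) (a : Fin 2 → ℕ → ℝ) (η : ℕ) :
    (aRow (initialBlock η a))ᵀ * aRow (initialBlock η a) = N • (information N a η - 1) := by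
  ext μ κ
  simp only [Matrix.mul_apply, aRow, transpose_apply, of_apply, initialBlock, Matrix.smul_apply,
    Matrix.sub_apply, information_apply, add_sub_cancel_left, smul_eq_mul]
  rw [mul_div_cancel₀ _ hN, ← Fin.sum_univ_eq_sum_range (fun s => a μ s * a κ s)]

theorem det_gram_ge {J₀ J₁ ρ : ℝ} (hτ : 0 < 1 - ρ ^ 2) (h₀ : 4 / (1 - ρ ^ 2) ≤ J₀)
    (h₁ : 4 / (1 - ρ ^ 2) ≤ J₁) :
    (1 - ρ ^ 2) / 2 * (J₀ * J₁) ≤ (J₀ - 1) * (J₁ - 1) - ρ ^ 2 * (J₀ * J₁) := by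
  have p0 : 0 < J₀ := lt_of_lt_of_le (by positivity) h₀
  have p1 : 0 < J₁ := lt_of_lt_of_le (by positivity) h₁
  rw [div_le_iff₀ hτ] at h₀ h₁
  nlinarith

section Gram

variable {N ρ : ℝ} {P : Fin 2 → ℝ} {m : ℕ}

theorem det_gram_ozarowBlock_ge (hN : 0 < N) (hρ : ρ ∈ Set.Ioo (0 : ℝ) 1) (hP : ∀ ν, 0 < P ν)
    (h : RhoEquation (P 0) (P 1) N ρ) (hm : ∀ ν, 4 / (1 - ρ ^ 2) ≤ precision N ρ (P ν) m) (k : ℕ) :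
    N ^ 2 * ((1 - ρ ^ 2) / 2 * (precision N ρ (P 0) m * precision N ρ (P 1) m)) ≤
      ((aRow (initialBlock (m + 1 + k) (ozarowBlock N ρ P m)))ᵀ *
        aRow (initialBlock (m + 1 + k) (ozarowBlock N ρ P m))).det := by
  rw [transpose_aRow_mul_aRow hN.ne', det_smul, Fintype.card_fin, information_ozarowBlock,
    min_eq_right (by omega), det_fin_two]
  simp only [Matrix.sub_apply, information_ozarowAmplitude_diag hN hρ hP, one_apply_eq,
    one_apply_ne zero_ne_one, one_apply_ne one_ne_zero, sub_zero]
  rw [information_apply_comm N (ozarowAmplitude N ρ P) (m + 1) 1 0, ← sq,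
    information_ozarowAmplitude_cross_sq hN hρ hP h]
  exact mul_le_mul_of_nonneg_left (det_gram_ge (one_sub_sq_pos hρ) (hm 0) (hm 1)) (sq_nonneg N)

theorem det_gram_ozarowBlock_pos (hN : 0 < N) (hρ : ρ ∈ Set.Ioo (0 : ℝ) 1) (hP : ∀ ν, 0 < P ν)
    (h : RhoEquation (P 0) (P 1) N ρ) (hm : ∀ ν, 4 / (1 - ρ ^ 2) ≤ precision N ρ (P ν) m) (k : ℕ) :
    0 < ((aRow (initialBlock (m + 1 + k) (ozarowBlock N ρ P m)))ᵀ *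
        aRow (initialBlock (m + 1 + k) (ozarowBlock N ρ P m))).det := by
  have := one_sub_sq_pos hρ
  have := precision_pos hN hρ (hP 0) m
  have := precision_pos hN hρ (hP 1) m
  exact lt_of_lt_of_le (by positivity) (det_gram_ozarowBlock_ge hN hρ hP h hm k)

end Gram

/-! ### Rates of the concatenated scheme under small feedback noise -/

section Rates

variable {η : ℕ}

theorem noiseCov_zero (N : ℝ) (B : Fin 2 → Matrix (Fin η) (Fin η) ℝ) :
    noiseCov N 0 B = N • (1 : Matrix (Fin η) (Fin η) ℝ) := by
  simp [noiseCov]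

theorem det_one_add_vecMulVec {ι : Type*} [Fintype ι] [DecidableEq ι] (u v : ι → ℝ) :
    (1 + vecMulVec u v).det = 1 + v ⬝ᵥ u := by
  rw [vecMulVec_eq Unit, det_one_add_replicateCol_mul_replicateRow]

theorem logDetRate_transpose_mul {ι : Type} [Fintype ι] [DecidableEq ι] {N : ℝ} (hN : N ≠ 0)
    {C : Matrix ι (Fin η) ℝ} (hC : (C * Cᵀ).det ≠ 0) (X : Matrix ι (Fin η) ℝ) :
    logDetRate C (Cᵀ * X) (N • 1) =
      1 / (2 * (η : ℝ)) * Real.log (1 + N⁻¹ • (X * Cᵀ)).det := by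
  have hnum : C * (Cᵀ * X + N • 1) * Cᵀ = N • (C * Cᵀ * (1 + N⁻¹ • (X * Cᵀ))) := by
    simp only [Matrix.mul_add, Matrix.add_mul, Matrix.mul_smul, Matrix.smul_mul, Matrix.mul_one,
      smul_add, smul_smul, mul_inv_cancel₀ hN, one_smul, Matrix.mul_assoc, add_comm]
  have hden : C * (N • (1 : Matrix (Fin η) (Fin η) ℝ)) * Cᵀ =
      N • (C * Cᵀ) := by simp
  rw [logDetRate, hnum, hden, det_smul, det_smul, det_mul, ← mul_assoc,
    mul_div_cancel_left₀ _ (mul_ne_zero (pow_ne_zero _ hN) hC)]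

variable {N : ℝ} {a : Fin 2 → ℕ → ℝ}

theorem logDetRate_aRow_mul_transpose (hN : N ≠ 0)
    (hG : ((aRow (initialBlock η a))ᵀ * aRow (initialBlock η a)).det ≠ 0) :
    logDetRate (aRow (initialBlock η a))ᵀ
      (aRow (initialBlock η a) * (aRow (initialBlock η a))ᵀ) (N • 1) =
        1 / (2 * (η : ℝ)) * Real.log (information N a η).det := by
  have h := logDetRate_transpose_mul hN (C := (aRow (initialBlock η a))ᵀ)
    (by rwa [transpose_transpose]) (aRow (initialBlock η a))ᵀ
  rwa [transpose_transpose, transpose_aRow_mul_aRow hN, smul_smul, inv_mul_cancel₀ hN, one_smul,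
    add_sub_cancel] at h

theorem logDetRate_vecMulVec (hN : N ≠ 0)
    (hG : ((aRow (initialBlock η a))ᵀ * aRow (initialBlock η a)).det ≠ 0) (ν : Fin 2) :
    logDetRate (aRow (initialBlock η a))ᵀ
      (vecMulVec (initialBlock η a ν) (initialBlock η a ν)) (N • 1) =
        1 / (2 * (η : ℝ)) * Real.log (information N a η ν ν) := by
  have hcol : aRow (initialBlock η a) *ᵥ Pi.single ν 1 = initialBlock η a ν := by
    ext s
    simp [aRow]
  have h := logDetRate_transpose_mul hN (C := (aRow (initialBlock η a))ᵀ)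
    (by rwa [transpose_transpose]) (vecMulVec (Pi.single ν 1) (initialBlock η a ν))
  rw [transpose_transpose, mul_vecMulVec, hcol, vecMulVec_mul, ← smul_vecMulVec,
    det_one_add_vecMulVec, dotProduct_smul, dotProduct_single, mul_one, smul_eq_mul,
    inv_mul_eq_div] at h
  rw [h, information_apply, one_apply_eq,
    ← Fin.sum_univ_eq_sum_range (fun s => a ν s * a ν s)]
  rfl

end Rates

section Continuity

variable {η : ℕ}

theorem continuous_kronecker_one {n : Type*} :
    Continuous fun K : Matrix n n ℝ => K ⊗ₖ (1 : Matrix (Fin η) (Fin η) ℝ) :=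
  continuous_matrix fun i j => by
    simp only [kroneckerMap_apply]
    fun_prop

theorem continuous_noiseCov (N : ℝ) (B : Fin 2 → Matrix (Fin η) (Fin η) ℝ) :
    Continuous fun K => noiseCov N K B := by
  have := continuous_kronecker_one (η := η) (n := Fin 2)
  unfold noiseCov
  fun_prop

theorem continuous_inputPower (N : ℝ) (a : Fin 2 → Fin η → ℝ)
    (B : Fin 2 → Matrix (Fin η) (Fin η) ℝ) (ν : Fin 2) :
    Continuous fun K => inputPower N K a B ν := by
  have := continuous_kronecker_one (η := η) (n := Fin 2)
  unfold inputPower inputCov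
  refine Continuous.matrix_trace (Continuous.matrix_submatrix ?_ _ _)
  fun_prop

/-- A nonnegative lower bound excludes a vanishing determinant in `logDetRate`. -/
theorem eventually_lt_logDetRate {N r : ℝ} {C : Matrix (Fin 2) (Fin η) ℝ}
    {S : Matrix (Fin η) (Fin η) ℝ} {B : Fin 2 → Matrix (Fin η) (Fin η) ℝ} (hr : 0 ≤ r)
    (h : r < logDetRate C S (noiseCov N 0 B)) :
    ∀ᶠ K in 𝓝 (0 : Matrix (Fin 2) (Fin 2) ℝ), r < logDetRate C S (noiseCov N K B) := by
  have hlog := right_ne_zero_of_mul (hr.trans_lt h).ne'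
  have hquot := (Real.log_ne_zero.1 hlog).1
  have hcov := continuous_noiseCov N B
  refine (show ContinuousAt (fun K => logDetRate C S (noiseCov N K B)) 0 from ?_).eventually
    (lt_mem_nhds h)
  refine continuousAt_const.mul (ContinuousAt.log (ContinuousAt.div ?_ ?_ ?_) hquot)
  · exact (Continuous.matrix_det (by fun_prop)).continuousAt
  · exact (Continuous.matrix_det (by fun_prop)).continuousAt
  · exact (div_ne_zero_iff.1 hquot).2

theorem eventually_mem_rateRegion {P R : Fin 2 → ℝ} {N : ℝ} {a : Fin 2 → Fin η → ℝ}
    {B : Fin 2 → Matrix (Fin η) (Fin η) ℝ} {C : Matrix (Fin 2) (Fin η) ℝ} (hη : 0 < η)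
    (hB : ∀ ν, IsStrictlyLower (B ν)) (hC : IsUnit (C * Cᵀ).det)
    (hpow : ∀ ν, inputPower N 0 a B ν < η * P ν) (hR : ∀ ν, 0 ≤ R ν)
    (hrate : ∀ ν, R ν < logDetRate C (vecMulVec (a ν) (a ν)) (noiseCov N 0 B))
    (hsum : R 0 + R 1 < logDetRate C (aRow a * (aRow a)ᵀ) (noiseCov N 0 B)) :
    ∀ᶠ K in 𝓝 (0 : Matrix (Fin 2) (Fin 2) ℝ), (R 0, R 1) ∈ rateRegion (P 0) (P 1) N K := by
  have hpowK : ∀ᶠ K in 𝓝 (0 : Matrix (Fin 2) (Fin 2) ℝ), ∀ ν, inputPower N K a B ν < η * P ν :=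
    eventually_all.2 fun ν =>
      (continuous_inputPower N a B ν).continuousAt.eventually (gt_mem_nhds (hpow ν))
  have hrateK : ∀ᶠ K in 𝓝 (0 : Matrix (Fin 2) (Fin 2) ℝ), ∀ ν,
      R ν < logDetRate C (vecMulVec (a ν) (a ν)) (noiseCov N K B) :=
    eventually_all.2 fun ν => eventually_lt_logDetRate (hR ν) (hrate ν)
  filter_upwards [hpowK, hrateK, eventually_lt_logDetRate (add_nonneg (hR 0) (hR 1)) hsum]
    with K hp hr hs
  exact subset_closure ⟨η, a, B, C, hη, hB, (hp 0).le, (hp 1).le,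
    Or.inl ⟨hC, hR 0, hR 1, (hr 0).le, (hr 1).le, hs.le⟩⟩

end Continuity

section SmallTrace

variable {n : Type*} [Fintype n]

theorem abs_apply_le_trace {K : Matrix n n ℝ} (hK : K.PosSemidef) (i j : n) :
    |K i j| ≤ K.trace := by
  classical
  have hdiag : ∀ i, 0 ≤ K i i := fun i => hK.diag_nonneg
  rcases eq_or_ne i j with rfl | hij
  · rw [abs_of_nonneg (hdiag i)]
    exact single_le_sum (f := fun i => K i i) (fun i _ => hdiag i) (mem_univ i)
  · have hdet := (hK.submatrix ![i, j]).det_nonneg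
    have hsym : K j i = K i j := by simpa using hK.1.apply i j
    have hadd : K i i + K j j ≤ K.trace := by
      rw [← sum_pair (f := fun i => K i i) hij]
      exact sum_le_sum_of_subset_of_nonneg (subset_univ _) fun i _ _ => hdiag i
    rw [det_fin_two] at hdet
    simp only [submatrix_apply, cons_val_zero, cons_val_one, cons_val_fin_one, hsym] at hdet
    have hij' : |K i j| ≤ K i i + K j j :=
      abs_le_of_sq_le_sq (by nlinarith [hdiag i, hdiag j]) (add_nonneg (hdiag i) (hdiag j))
    exact hij'.trans hadd

theorem exists_trace_le_imp_mem_of_mem_nhds_zero {U : Set (Matrix n n ℝ)} (hU : U ∈ 𝓝 0) :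
    ∃ σ > (0 : ℝ), ∀ K : Matrix n n ℝ, K.PosSemidef → K.trace ≤ σ ^ 2 → K ∈ U := by
  obtain ⟨ε, hε, hball⟩ := Metric.mem_nhds_iff.1
    (show (U : Set (n → n → ℝ)) ∈ 𝓝 (0 : n → n → ℝ) from hU)
  refine ⟨√(ε / 2), by positivity, fun K hK htr => hball ?_⟩
  rw [Real.sq_sqrt (by positivity)] at htr
  have hentry : ∀ i j, ‖K i j‖ < ε := fun i j =>
    ((abs_apply_le_trace hK i j).trans htr).trans_lt (half_lt_self hε)
  exact mem_ball_zero_iff.2 ((pi_norm_lt_iff hε).2 fun i =>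
    (pi_norm_lt_iff hε).2 fun j => hentry i j)

end SmallTrace

theorem mem_vanishingNoiseRegion_of_eventually {P₁ P₂ N : ℝ} {R : ℝ × ℝ}
    (h : ∀ᶠ K in 𝓝 0, R ∈ rateRegion P₁ P₂ N K) : R ∈ vanishingNoiseRegion P₁ P₂ N := by
  obtain ⟨σ, hσ, hK⟩ := exists_trace_le_imp_mem_of_mem_nhds_zero h
  exact Set.mem_iUnion₂.2 ⟨σ, hσ, Set.mem_iInter₂.2 fun K hKm => hK K hKm.1 hKm.2⟩

/-! ### The rectangle of Ozarow -/

theorem tendsto_affine_div (k : ℕ) (l c : ℝ) :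
    Tendsto (fun m : ℕ => 1 / (2 * ((m + 1 + k : ℕ) : ℝ)) * (m * l + c)) atTop
      (𝓝 (1 / 2 * l)) := by
  have hz : Tendsto (fun m : ℕ => (1 : ℝ) / ((m + 1 + k : ℕ) : ℝ)) atTop (𝓝 0) := by
    have := (tendsto_one_div_atTop_nhds_zero_nat (𝕜 := ℝ)).comp (tendsto_add_atTop_nat (1 + k))
    exact this.congr fun m => by simp [add_assoc]
  have := (hz.mul_const ((c - (1 + k) * l) / 2)).const_add (1 / 2 * l)
  rw [zero_mul, add_zero] at this
  refine this.congr fun m => ?_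
  have hm : ((m : ℝ) + 1 + k) ≠ 0 := by positivity
  push_cast
  field_simp
  ring

section Rectangle

variable {N ρ : ℝ}

theorem log_precision {p : ℝ} (hN : 0 < N) (hρ : ρ ∈ Set.Ioo (0 : ℝ) 1) (hp : 0 < p) (m : ℕ) :
    Real.log (precision N ρ p m) = m * Real.log (gain N ρ p) - Real.log (1 - ρ) := by
  rw [precision, Real.log_div (pow_ne_zero m (gain_pos hN hρ hp).ne') (sub_pos.2 hρ.2).ne',
    Real.log_pow]

variable {P R : Fin 2 → ℝ}

theorem eventually_lt_log_precision {p r : ℝ} (hN : 0 < N) (hρ : ρ ∈ Set.Ioo (0 : ℝ) 1)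
    (hp : 0 < p) (hr : r < 1 / 2 * Real.log (gain N ρ p)) (k : ℕ) :
    ∀ᶠ m : ℕ in atTop,
      r < 1 / (2 * ((m + 1 + k : ℕ) : ℝ)) * Real.log (precision N ρ p m) := by
  simp only [log_precision hN hρ hp, sub_eq_add_neg]
  exact (tendsto_affine_div k _ _).eventually (lt_mem_nhds hr)

theorem eventually_lt_log_det_information (hN : 0 < N) (hρ : ρ ∈ Set.Ioo (0 : ℝ) 1)
    (hP : ∀ ν, 0 < P ν) (hR : ∀ ν, R ν < 1 / 2 * Real.log (gain N ρ (P ν))) (k : ℕ) :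
    ∀ᶠ m : ℕ in atTop, R 0 + R 1 < 1 / (2 * ((m + 1 + k : ℕ) : ℝ)) *
      Real.log ((1 - ρ ^ 2) * (precision N ρ (P 0) m * precision N ρ (P 1) m)) := by
  have hlt : R 0 + R 1 <
      1 / 2 * (Real.log (gain N ρ (P 0)) + Real.log (gain N ρ (P 1))) := by
    rw [mul_add]
    exact add_lt_add (hR 0) (hR 1)
  filter_upwards [(tendsto_affine_div k _ (Real.log (1 - ρ ^ 2) - 2 * Real.log (1 - ρ))).eventually
    (lt_mem_nhds hlt)] with m hm
  have h₀ := precision_pos hN hρ (hP 0) m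
  have h₁ := precision_pos hN hρ (hP 1) m
  rw [Real.log_mul (one_sub_sq_pos hρ).ne' (by positivity), Real.log_mul h₀.ne' h₁.ne',
    log_precision hN hρ (hP 0), log_precision hN hρ (hP 1)]
  exact hm.trans_eq (by ring)

theorem eventually_mem_rateRegion_of_lt (hN : 0 < N) (hρ : ρ ∈ Set.Ioo (0 : ℝ) 1)
    (hP : ∀ ν, 0 < P ν) (h : RhoEquation (P 0) (P 1) N ρ) (hR0 : ∀ ν, 0 ≤ R ν)
    (hR : ∀ ν, R ν < 1 / 2 * Real.log (gain N ρ (P ν))) :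
    ∀ᶠ K in 𝓝 0, (R 0, R 1) ∈ rateRegion (P 0) (P 1) N K := by
  obtain ⟨k, hpow⟩ := exists_forall_linearPower_ozarowBlock_lt hN hρ hP h
  have hgram : ∀ᶠ m in atTop, ∀ ν, 4 / (1 - ρ ^ 2) ≤ precision N ρ (P ν) m :=
    eventually_all.2 fun ν => (tendsto_precision_atTop hN hρ (hP ν)).eventually_ge_atTop _
  have hsingle : ∀ᶠ m : ℕ in atTop, ∀ ν,
      R ν < 1 / (2 * ((m + 1 + k : ℕ) : ℝ)) * Real.log (precision N ρ (P ν) m) :=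
    eventually_all.2 fun ν => eventually_lt_log_precision hN hρ (hP ν) (hR ν) k
  obtain ⟨m, hm, hrate, hsum⟩ :=
    (hgram.and (hsingle.and (eventually_lt_log_det_information hN hρ hP hR k))).exists
  have hG := (det_gram_ozarowBlock_pos hN hρ hP h hm k).ne'
  have hF := isStrictlyLower_mmseFeedback N (ozarowBlock N ρ P m) (m + 1 + k)
  refine eventually_mem_rateRegion (a := initialBlock (m + 1 + k) (ozarowBlock N ρ P m))
    (B := feedbackMatrix (mmseFeedback N (ozarowBlock N ρ P m) (m + 1 + k)))
    (C := (aRow (initialBlock (m + 1 + k) (ozarowBlock N ρ P m)))ᵀ) (by omega)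
    (isStrictlyLower_feedbackMatrix hF) (by rwa [transpose_transpose, isUnit_iff_ne_zero])
    (fun ν => ?_) hR0 (fun ν => ?_) ?_
  · rw [inputPower_feedbackMatrix N _ hF]
    exact hpow m ν
  · rw [noiseCov_zero, logDetRate_vecMulVec hN.ne' hG, information_ozarowBlock,
      min_eq_right (by omega), information_ozarowAmplitude_diag hN hρ hP]
    exact hrate ν
  · rw [noiseCov_zero, logDetRate_aRow_mul_transpose hN.ne' hG, information_ozarowBlock,
      min_eq_right (by omega), det_information_ozarowAmplitude hN hρ hP h]
    exact hsum

end Rectangle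

section Corner

variable {P₁ P₂ N : ℝ}

theorem ozarowCorner_fst : (ozarowCorner P₁ P₂ N).1 =
    1 / 2 * Real.log (gain N (rhoStar P₁ P₂ N) P₁) := rfl

theorem ozarowCorner_snd : (ozarowCorner P₁ P₂ N).2 =
    1 / 2 * Real.log (gain N (rhoStar P₁ P₂ N) P₂) := rfl

theorem mem_vanishingNoiseRegion_of_lt (hP₁ : 0 < P₁) (hP₂ : 0 < P₂) (hN : 0 < N) {R : ℝ × ℝ}
    (h₁ : 0 ≤ R.1) (h₂ : 0 ≤ R.2) (hR₁ : R.1 < (ozarowCorner P₁ P₂ N).1)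
    (hR₂ : R.2 < (ozarowCorner P₁ P₂ N).2) : R ∈ vanishingNoiseRegion P₁ P₂ N :=
  mem_vanishingNoiseRegion_of_eventually <|
    eventually_mem_rateRegion_of_lt (P := ![P₁, P₂]) (R := ![R.1, R.2]) hN
      (rhoStar_mem_Ioo hP₁ hP₂ hN) (Fin.forall_fin_two.2 ⟨hP₁, hP₂⟩)
      (rhoStar_spec hP₁ hP₂ hN).2 (Fin.forall_fin_two.2 ⟨h₁, h₂⟩)
      (Fin.forall_fin_two.2 ⟨hR₁, hR₂⟩)

theorem half_log_gain_pos {ρ p : ℝ} (hN : 0 < N) (hρ : ρ ∈ Set.Ioo (0 : ℝ) 1) (hp : 0 < p) :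
    0 < 1 / 2 * Real.log (gain N ρ p) :=
  mul_pos one_half_pos (Real.log_pos (one_lt_gain hN hρ hp))

theorem ozarowRegion_subset_closure (hP₁ : 0 < P₁) (hP₂ : 0 < P₂) (hN : 0 < N) :
    ozarowRegion P₁ P₂ N (rhoStar P₁ P₂ N) ⊆ closure (vanishingNoiseRegion P₁ P₂ N) := by
  rintro R ⟨h₁, h₂, hR₁, hR₂, -⟩
  have hρ := rhoStar_mem_Ioo hP₁ hP₂ hN
  have hlim : Tendsto (fun c : ℝ => c • R) (𝓝[<] 1) (𝓝 R) := by
    have : Continuous fun c : ℝ => c • R := by fun_prop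
    simpa using (this.tendsto 1).mono_left nhdsWithin_le_nhds
  refine mem_closure_of_tendsto hlim ?_
  filter_upwards [Ioo_mem_nhdsLT (zero_lt_one (α := ℝ))] with c hc
  have hlt : ∀ x y : ℝ, x ≤ y → 0 < y → c * x < y := fun x y hxy hy =>
    (mul_le_mul_of_nonneg_left hxy hc.1.le).trans_lt (mul_lt_of_lt_one_left hy hc.2)
  exact mem_vanishingNoiseRegion_of_lt hP₁ hP₂ hN (mul_nonneg hc.1.le h₁) (mul_nonneg hc.1.le h₂)
    (hlt _ _ hR₁ (half_log_gain_pos hN hρ hP₁)) (hlt _ _ hR₂ (half_log_gain_pos hN hρ hP₂))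

theorem ozarowCorner_fst_add_snd (hP₁ : 0 < P₁) (hP₂ : 0 < P₂) (hN : 0 < N) :
    (ozarowCorner P₁ P₂ N).1 + (ozarowCorner P₁ P₂ N).2 = 1 / 2 * Real.log
      (1 + (P₁ + P₂ + 2 * √(P₁ * P₂) * rhoStar P₁ P₂ N) / N) := by
  have hρ := rhoStar_mem_Ioo hP₁ hP₂ hN
  rw [ozarowCorner_fst, ozarowCorner_snd, ← mul_add,
    ← Real.log_mul (gain_pos hN hρ hP₁).ne' (gain_pos hN hρ hP₂).ne',
    (rhoStar_spec hP₁ hP₂ hN).2.gain_mul_gain hN.ne']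

theorem ozarowCorner_mem_ozarowRegion (hP₁ : 0 < P₁) (hP₂ : 0 < P₂) (hN : 0 < N) :
    ozarowCorner P₁ P₂ N ∈ ozarowRegion P₁ P₂ N (rhoStar P₁ P₂ N) :=
  have hρ := rhoStar_mem_Ioo hP₁ hP₂ hN
  ⟨(half_log_gain_pos hN hρ hP₁).le, (half_log_gain_pos hN hρ hP₂).le, le_rfl, le_rfl,
    (ozarowCorner_fst_add_snd hP₁ hP₂ hN).le⟩

theorem exists_mem_rateRegion_dist_ozarowCorner_lt (hP₁ : 0 < P₁) (hP₂ : 0 < P₂) (hN : 0 < N)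
    {ε : ℝ} (hε : 0 < ε) : ∃ σ > (0 : ℝ), ∀ K : Matrix (Fin 2) (Fin 2) ℝ,
      K.PosSemidef → K.trace ≤ σ ^ 2 →
        ∃ R ∈ rateRegion P₁ P₂ N K, dist R (ozarowCorner P₁ P₂ N) < ε := by
  obtain ⟨R, hR, hd⟩ := Metric.mem_closure_iff.1 (ozarowRegion_subset_closure hP₁ hP₂ hN
    (ozarowCorner_mem_ozarowRegion hP₁ hP₂ hN)) ε hε
  obtain ⟨σ, hσ, hK⟩ := Set.mem_iUnion₂.1 hR
  exact ⟨σ, hσ, fun K hp ht => ⟨R, Set.mem_iInter₂.1 hK K ⟨hp, ht⟩, by rwa [dist_comm]⟩⟩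

end Corner

/-! ### Causal changes of variables -/

section Shear

variable {n : ℕ}

/-- The coordinates of `y` before time `t`, what a causal system has seen when it acts at
time `t`. -/
def past (y : Fin n → ℝ) (t : Fin n) : Fin t → ℝ := fun i => y (Fin.castLE t.isLt.le i)

/-- The causal change of variables that subtracts from each coordinate a function of the previous
ones; it takes the channel outputs to the noise when `h` is the sum of the channel inputs. -/
def shear (h : (t : Fin n) → (Fin t → ℝ) → ℝ) (y : Fin n → ℝ) (t : Fin n) : ℝ :=
  y t - h t (past y t)

theorem measurable_past (t : Fin n) : Measurable fun y : Fin n → ℝ => past y t :=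
  measurable_pi_lambda _ fun _ => measurable_pi_apply _

theorem measurable_shear {h : (t : Fin n) → (Fin t → ℝ) → ℝ} (hh : ∀ t, Measurable (h t)) :
    Measurable (shear h) :=
  measurable_pi_lambda _ fun t => (measurable_pi_apply t).sub ((hh t).comp (measurable_past t))

theorem shear_castSucc (h : (t : Fin (n + 1)) → (Fin t → ℝ) → ℝ) (y : Fin (n + 1) → ℝ)
    (t : Fin n) :
    shear h y t.castSucc = shear (fun t => h t.castSucc) (fun i => y i.castSucc) t := rfl

theorem shear_last (h : (t : Fin (n + 1)) → (Fin t → ℝ) → ℝ) (y : Fin (n + 1) → ℝ) :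
    shear h y (Fin.last n) = y (Fin.last n) - h (Fin.last n) fun i => y i.castSucc := rfl

theorem piFinSuccAbove_last_shear (h : (t : Fin (n + 1)) → (Fin t → ℝ) → ℝ)
    (y : Fin (n + 1) → ℝ) :
    MeasurableEquiv.piFinSuccAbove (fun _ => ℝ) (Fin.last n) (shear h y) =
      let p := MeasurableEquiv.piFinSuccAbove (fun _ => ℝ) (Fin.last n) y
      (p.1 - h (Fin.last n) p.2, shear (fun t => h t.castSucc) p.2) := by
  have init (y : Fin (n + 1) → ℝ) :
      (MeasurableEquiv.piFinSuccAbove (fun _ => ℝ) (Fin.last n) y).2 = fun i => y i.castSucc :=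
    funext fun i => congrArg y (Fin.succAbove_last_apply i)
  refine Prod.ext ?_ ?_
  · exact (shear_last h y).trans (congrArg (fun v => y (Fin.last n) - h (Fin.last n) v)
      (init y).symm)
  · exact (init _).trans (funext fun t => (shear_castSucc h y t).trans
      (congrArg (fun v => shear (fun t => h t.castSucc) v t) (init y).symm))

theorem measurePreserving_sub_prodMk {α : Type*} [MeasurableSpace α] {μ : Measure α} [SFinite μ]
    {f : α → α} (hf : MeasurePreserving f μ μ) {g : α → ℝ} (hg : Measurable g) :
    MeasurePreserving (fun p : ℝ × α => (p.1 - g p.2, f p.2)) (volume.prod μ) (volume.prod μ) := by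
  have hskew : MeasurePreserving (fun p : α × ℝ => (f p.1, p.2 - g p.1)) (μ.prod volume)
      (μ.prod volume) :=
    hf.skew_product (g := fun x b => b - g x) (measurable_snd.sub (hg.comp measurable_fst))
      (Eventually.of_forall fun x => (measurePreserving_sub_right volume _).map_eq)
  exact Measure.measurePreserving_swap.comp (hskew.comp Measure.measurePreserving_swap)

theorem measurePreserving_shear : ∀ {n : ℕ} {h : (t : Fin n) → (Fin t → ℝ) → ℝ},
    (∀ t, Measurable (h t)) → MeasurePreserving (shear h) volume volume
  | 0, h, _ => by
    rw [show shear h = id from funext fun y => funext fun t => t.elim0]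
    exact .id _
  | n + 1, h, hh => by
    let e := MeasurableEquiv.piFinSuccAbove (fun _ : Fin (n + 1) => ℝ) (Fin.last n)
    have he : MeasurePreserving e volume volume := volume_preserving_piFinSuccAbove _ _
    have hsub := measurePreserving_sub_prodMk
      (measurePreserving_shear fun t : Fin n => hh t.castSucc) (hh (Fin.last n))
    have hconj : shear h = e.symm ∘
        (fun p => (p.1 - h (Fin.last n) p.2, shear (fun t => h t.castSucc) p.2)) ∘ e :=
      funext fun y => (MeasurableEquiv.eq_symm_apply e).2 (piFinSuccAbove_last_shear h y)
    exact hconj ▸ (he.symm e).comp (hsub.comp he)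

end Shear

/-! ### Gaussian densities -/

section GaussianDensity

variable {n : ℕ}

theorem lintegral_prod_apply : ∀ {n : ℕ} {g : Fin n → ℝ → ℝ≥0∞}, (∀ i, Measurable (g i)) →
    ∫⁻ z : Fin n → ℝ, ∏ i, g i (z i) = ∏ i, ∫⁻ x, g i x
  | 0, g, _ => by simp [volume_pi, Measure.pi_empty_univ]
  | n + 1, g, hg => by
    rw [Fin.prod_univ_succ, ← lintegral_prod_apply fun i => hg i.succ,
      ← lintegral_prod_mul (hg 0).aemeasurable
        (Finset.measurable_fun_prod _ fun i _ =>
          (hg i.succ).comp (measurable_pi_apply i)).aemeasurable, ← Measure.volume_eq_prod,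
      ← (volume_preserving_piFinSuccAbove (fun _ : Fin (n + 1) => ℝ) 0).lintegral_comp_emb
        (MeasurableEquiv.measurableEmbedding _)]
    refine lintegral_congr fun z => ?_
    rw [Fin.prod_univ_succ]
    rfl

/-- The density of `n` i.i.d. centred Gaussians of variance `v`. -/
def iidDensity (v : ℝ) (z : Fin n → ℝ) : ℝ≥0∞ := ∏ i, gaussianPDF 0 v.toNNReal (z i)

theorem measurable_iidDensity (v : ℝ) : Measurable (iidDensity (n := n) v) :=
  Finset.measurable_fun_prod _ fun i _ =>
    (measurable_gaussianPDF 0 v.toNNReal).comp (measurable_pi_apply i)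

instance isProbabilityMeasure_noiseLaw (N : ℝ) : IsProbabilityMeasure (noiseLaw n N) := by
  unfold noiseLaw
  infer_instance

theorem indicator_pi_iidDensity (v : ℝ) (s : Fin n → Set ℝ) (z : Fin n → ℝ) :
    (Set.univ.pi s).indicator (iidDensity v) z =
      ∏ i, (s i).indicator (gaussianPDF 0 v.toNNReal) (z i) := by
  by_cases hz : z ∈ Set.univ.pi s
  · rw [Set.indicator_of_mem hz]
    exact prod_congr rfl fun i _ => (Set.indicator_of_mem (hz i (Set.mem_univ i)) _).symm
  · rw [Set.indicator_of_notMem hz]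
    obtain ⟨i, hi⟩ : ∃ i, z i ∉ s i := by simpa [Set.mem_pi] using hz
    exact (prod_eq_zero (mem_univ i) (Set.indicator_of_notMem hi _)).symm

theorem noiseLaw_eq_withDensity {N : ℝ} (hN : 0 < N) :
    noiseLaw n N = volume.withDensity (iidDensity N) := by
  refine Measure.pi_eq fun s hs => ?_
  have hms := MeasurableSet.univ_pi hs
  rw [withDensity_apply _ hms, ← lintegral_indicator hms,
    lintegral_congr (indicator_pi_iidDensity N s),
    lintegral_prod_apply fun i => (measurable_gaussianPDF 0 N.toNNReal).indicator (hs i)]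
  refine prod_congr rfl fun i _ => ?_
  rw [lintegral_indicator (hs i), gaussianReal_apply _ (by simpa using hN)]

theorem gaussianPDFReal_mul_exp {N s : ℝ} (hN : 0 < N) (hs : 0 < s) (z u : ℝ) :
    gaussianPDFReal 0 N.toNNReal z *
      Real.exp (-(1 / 2 * Real.log (s / N) + u ^ 2 / (2 * s) - z ^ 2 / (2 * N))) =
      gaussianPDFReal 0 s.toNNReal u := by
  have hsqrt : Real.exp (-(1 / 2 * Real.log (s / N))) = √N / √s := by
    rw [← Real.sqrt_div hN.le, Real.sqrt_eq_rpow, Real.rpow_def_of_pos (by positivity),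
      ← inv_div s N, Real.log_inv]
    ring_nf
  have hexp : Real.exp (-z ^ 2 / (2 * N)) * Real.exp (z ^ 2 / (2 * N)) = 1 := by
    rw [← Real.exp_add, neg_div, neg_add_cancel, Real.exp_zero]
  have hsplit : Real.exp (-(1 / 2 * Real.log (s / N) + u ^ 2 / (2 * s) - z ^ 2 / (2 * N))) =
      √N / √s * Real.exp (-u ^ 2 / (2 * s)) * Real.exp (z ^ 2 / (2 * N)) := by
    rw [← hsqrt, ← Real.exp_add, ← Real.exp_add]
    ring_nf
  simp only [gaussianPDFReal_def, Real.coe_toNNReal _ hN.le, Real.coe_toNNReal _ hs.le, sub_zero]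
  rw [hsplit, Real.sqrt_mul (by positivity) N, Real.sqrt_mul (by positivity) s]
  have _ : 0 < √N := Real.sqrt_pos.2 hN
  calc _ = (√(2 * Real.pi) * √N)⁻¹ * (√N / √s) * Real.exp (-u ^ 2 / (2 * s)) *
        (Real.exp (-z ^ 2 / (2 * N)) * Real.exp (z ^ 2 / (2 * N))) := by ring
    _ = (√(2 * Real.pi) * √s)⁻¹ * Real.exp (-u ^ 2 / (2 * s)) := by
      rw [hexp, mul_one]
      field_simp

/-- The logarithm of the density at noise `z` of i.i.d. Gaussians of variance `N`, relative to
the density at `u` of i.i.d. Gaussians of variance `s`. -/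
def logRatio (N s : ℝ) (u z : Fin n → ℝ) : ℝ :=
  ∑ t, (1 / 2 * Real.log (s / N) + u t ^ 2 / (2 * s) - z t ^ 2 / (2 * N))

theorem iidDensity_mul_exp_neg_logRatio {N s : ℝ} (hN : 0 < N) (hs : 0 < s) (u z : Fin n → ℝ) :
    iidDensity N z * ENNReal.ofReal (Real.exp (-logRatio N s u z)) = iidDensity s u := by
  rw [logRatio, ← sum_neg_distrib, Real.exp_sum,
    ENNReal.ofReal_prod_of_nonneg fun _ _ => (Real.exp_pos _).le, iidDensity, ← prod_mul_distrib]
  refine prod_congr rfl fun t _ => ?_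
  rw [gaussianPDF, ← ENNReal.ofReal_mul (gaussianPDFReal_nonneg _ _ _),
    gaussianPDFReal_mul_exp hN hs, gaussianPDF]

theorem measurable_logRatio (N s : ℝ) {α : Type*} [MeasurableSpace α] {u z : α → Fin n → ℝ}
    (hu : Measurable u) (hz : Measurable z) : Measurable fun y => logRatio N s (u y) (z y) :=
  Finset.measurable_fun_sum _ fun _ _ => by fun_prop

/-- The law of a sequence whose conditional mean given its past is `h` and whose innovations are
i.i.d. centred Gaussians of variance `v`: the law of the channel outputs when the inputs sum
to `h`. -/
def causalGaussian (v : ℝ) (h : (t : Fin n) → (Fin t → ℝ) → ℝ) : Measure (Fin n → ℝ) :=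
  volume.withDensity fun y => iidDensity v (shear h y)

variable {h x : (t : Fin n) → (Fin t → ℝ) → ℝ}

theorem map_shear_causalGaussian {N : ℝ} (hN : 0 < N) (hh : ∀ t, Measurable (h t)) :
    (causalGaussian N h).map (shear h) = noiseLaw n N := by
  ext S hS
  have hm := measurable_shear hh
  rw [Measure.map_apply hm hS, causalGaussian, withDensity_apply _ (hm hS),
    (measurePreserving_shear hh).setLIntegral_comp_preimage hS (measurable_iidDensity N),
    noiseLaw_eq_withDensity hN, withDensity_apply _ hS]

theorem isProbabilityMeasure_causalGaussian {v : ℝ} (hv : 0 < v) (hh : ∀ t, Measurable (h t)) :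
    IsProbabilityMeasure (causalGaussian v h) := by
  rw [← Measure.isProbabilityMeasure_map_iff (measurable_shear hh).aemeasurable,
    map_shear_causalGaussian hv hh]
  infer_instance

theorem map_noiseLaw_eq_causalGaussian {N : ℝ} (hN : 0 < N) (hh : ∀ t, Measurable (h t))
    {T : (Fin n → ℝ) → Fin n → ℝ} (hT : Measurable T) (hTh : ∀ y, T (shear h y) = y) :
    (noiseLaw n N).map T = causalGaussian N h := by
  rw [← map_shear_causalGaussian hN hh, Measure.map_map hT (measurable_shear hh),
    show T ∘ shear h = id from funext hTh, Measure.map_id]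

theorem causalGaussian_withDensity {N s : ℝ} (hN : 0 < N) (hs : 0 < s)
    (hh : ∀ t, Measurable (h t)) (hx : ∀ t, Measurable (x t)) :
    (causalGaussian N x).withDensity (fun y =>
      ENNReal.ofReal (Real.exp (-logRatio N s (shear h y) (shear x y)))) = causalGaussian s h := by
  have hmx := measurable_shear hx
  have hmr := measurable_logRatio N s (measurable_shear hh) hmx
  exact (withDensity_mul volume (f := fun y => iidDensity N (shear x y))
    ((measurable_iidDensity N).comp hmx) (by fun_prop)).symm.trans
    (congrArg _ (funext fun y => iidDensity_mul_exp_neg_logRatio hN hs _ _))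

end GaussianDensity

/-! ### Converse bounds by change of measure -/

section ChangeOfMeasure

variable {Ω : Type*} [MeasurableSpace Ω]

theorem log_mul_measureReal_le {W ν : Measure Ω} [IsProbabilityMeasure W] [IsProbabilityMeasure ν]
    {ℓ : Ω → ℝ} (hℓ : Integrable ℓ W)
    (hν : W.withDensity (fun ω => ENNReal.ofReal (Real.exp (-ℓ ω))) = ν)
    {E : Set Ω} (hE : MeasurableSet E) {L : ℝ} (hL : 0 < L) :
    Real.log L * W.real E ≤ ∫ ω, ℓ ω ∂W + (L - 1) * ν.real E := by
  set g : Ω → ℝ := fun ω => 1 + E.indicator (fun _ => L - 1) ω with hg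
  set f : Ω → ℝ := E.indicator fun _ => Real.log L
  have hexp (ω : Ω) : Real.exp (f ω - ℓ ω) = Real.exp (-ℓ ω) * g ω := by
    rw [sub_eq_neg_add, Real.exp_add]
    by_cases hω : ω ∈ E <;> simp [f, g, hω, Real.exp_log hL]
  have hdens : AEMeasurable (fun ω => ENNReal.ofReal (Real.exp (-ℓ ω))) W := by
    have := hℓ.aemeasurable
    fun_prop
  have hind (c : ℝ) (μ : Measure Ω) [IsProbabilityMeasure μ] :
      Integrable (E.indicator fun _ => c) μ := (integrable_const c).indicator hE
  have hgi : Integrable (fun ω => Real.exp (-ℓ ω) * g ω) W := by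
    have hgν : Integrable g ν := (integrable_const 1).add (hind _ ν)
    rw [← hν, integrable_withDensity_iff_integrable_smul₀' hdens
      (Eventually.of_forall fun _ => ENNReal.ofReal_lt_top)] at hgν
    simpa only [ENNReal.toReal_ofReal (Real.exp_pos _).le, smul_eq_mul] using hgν
  have hgI : ∫ ω, Real.exp (-ℓ ω) * g ω ∂W = 1 + (L - 1) * ν.real E := by
    have hgν : ∫ ω, g ω ∂ν = 1 + (L - 1) * ν.real E := by
      rw [hg, integral_add (integrable_const 1) (hind _ ν), integral_indicator_const _ hE]
      simp [mul_comm]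
    rw [← hgν, ← hν, integral_withDensity_eq_integral_toReal_smul₀ hdens
      (Eventually.of_forall fun _ => ENNReal.ofReal_lt_top)]
    simp only [ENNReal.toReal_ofReal (Real.exp_pos _).le, smul_eq_mul]
  have hmono : ∫ ω, (f ω - ℓ ω) ∂W ≤ ∫ ω, (Real.exp (-ℓ ω) * g ω - 1) ∂W :=
    integral_mono ((hind _ W).sub hℓ) (hgi.sub (integrable_const 1)) fun ω => by
      have := Real.add_one_le_exp (f ω - ℓ ω)
      rw [hexp] at this
      linarith
  rw [integral_sub (hind _ W) hℓ, integral_sub hgi (integrable_const 1), hgI,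
    integral_indicator_const _ hE] at hmono
  simp only [smul_eq_mul, integral_const, probReal_univ, mul_one] at hmono
  linarith [mul_comm (Real.log L) (W.real E)]

theorem log_card_mul_sum_measureReal_le {ι : Type*} [Fintype ι] [Nonempty ι] {W : ι → Measure Ω}
    [∀ i, IsProbabilityMeasure (W i)] {ν : Measure Ω} [IsProbabilityMeasure ν] {ℓ : ι → Ω → ℝ}
    (hℓ : ∀ i, Integrable (ℓ i) (W i))
    (hν : ∀ i, (W i).withDensity (fun ω => ENNReal.ofReal (Real.exp (-ℓ i ω))) = ν)
    {E : ι → Set Ω} (hE : ∀ i, MeasurableSet (E i))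
    (hdisj : Pairwise fun i j => Disjoint (E i) (E j)) :
    Real.log (Fintype.card ι) * ∑ i, (W i).real (E i) ≤
      ∑ i, ∫ ω, ℓ i ω ∂(W i) + Fintype.card ι := by
  have hcard : (1 : ℝ) ≤ Fintype.card ι := by exact_mod_cast Fintype.card_pos
  have hsum : ∑ i, ν.real (E i) ≤ 1 := by
    rw [← measureReal_iUnion_fintype hdisj hE]
    exact measureReal_le_one
  calc Real.log (Fintype.card ι) * ∑ i, (W i).real (E i)
      ≤ ∑ i, (∫ ω, ℓ i ω ∂(W i) + (Fintype.card ι - 1) * ν.real (E i)) := by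
        rw [mul_sum]
        exact sum_le_sum fun i _ =>
          log_mul_measureReal_le (hℓ i) (hν i) (hE i) (by linarith)
    _ = ∑ i, ∫ ω, ℓ i ω ∂(W i) + (Fintype.card ι - 1) * ∑ i, ν.real (E i) := by
        rw [sum_add_distrib, mul_sum]
    _ ≤ _ := by nlinarith

end ChangeOfMeasure

/-! ### Outputs and inputs of a feedback code -/

namespace FeedbackCode

variable {n : ℕ} (c : FeedbackCode n) (m₁ : Fin c.M₁) (m₂ : Fin c.M₂)

/-- The sum of the two channel inputs as a causal function of the outputs. -/
def totalInput (t : Fin n) (p : Fin t → ℝ) : ℝ := c.enc₁ t m₁ p + c.enc₂ t m₂ p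

/-- The vector of all channel outputs. -/
def received (z : Fin n → ℝ) : Fin n → ℝ := c.output m₁ m₂ z n le_rfl

theorem measurable_totalInput (t : Fin n) : Measurable (c.totalInput m₁ m₂ t) :=
  (c.measurable_enc₁ t m₁).add (c.measurable_enc₂ t m₂)

theorem output_castLE (z : Fin n → ℝ) {t : ℕ} : ∀ {s : ℕ} (hts : t ≤ s) (hs : s ≤ n) (i : Fin t),
    c.output m₁ m₂ z s hs (Fin.castLE hts i) = c.output m₁ m₂ z t (hts.trans hs) i
  | 0, hts, hs, i => (Nat.not_lt_zero _ (i.isLt.trans_le hts)).elim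
  | s + 1, hts, hs, i => by
    rcases Nat.lt_or_ge s t with h | h
    · obtain rfl : t = s + 1 := by omega
      rfl
    · rw [show Fin.castLE hts i = (Fin.castLE h i).castSucc from rfl, output, Fin.snoc_castSucc,
        output_castLE z h _ i]

theorem past_received (z : Fin n → ℝ) (t : Fin n) :
    past (c.received m₁ m₂ z) t = c.output m₁ m₂ z t t.isLt.le :=
  funext fun i => c.output_castLE m₁ m₂ z t.isLt.le le_rfl i

theorem received_apply (z : Fin n → ℝ) (t : Fin n) :
    c.received m₁ m₂ z t = c.totalInput m₁ m₂ t (c.output m₁ m₂ z t t.isLt.le) + z t := by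
  have h := c.output_castLE m₁ m₂ z (t := t + 1) t.isLt le_rfl (Fin.last t)
  rw [show Fin.castLE (Nat.succ_le_of_lt t.isLt) (Fin.last (t : ℕ)) = t from rfl] at h
  rw [received, h, output, Fin.snoc_last]
  rfl

theorem output_eq_of_forall (y z : Fin n → ℝ)
    (h : ∀ t, y t = c.totalInput m₁ m₂ t (past y t) + z t) :
    ∀ (t : ℕ) (ht : t ≤ n), c.output m₁ m₂ z t ht = fun i => y (Fin.castLE ht i)
  | 0, _ => funext fun i => i.elim0
  | t + 1, ht => by
    have ih := output_eq_of_forall y z h t (Nat.le_of_succ_le ht)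
    funext i
    refine Fin.lastCases ?_ (fun j => ?_) i
    · rw [output, Fin.snoc_last, ih]
      exact (h ⟨t, ht⟩).symm
    · rw [output, Fin.snoc_castSucc, ih]
      rfl

theorem received_eq_of_forall {y z : Fin n → ℝ}
    (h : ∀ t, y t = c.totalInput m₁ m₂ t (past y t) + z t) : c.received m₁ m₂ z = y :=
  c.output_eq_of_forall m₁ m₂ y z h n le_rfl

theorem received_shear (y : Fin n → ℝ) :
    c.received m₁ m₂ (shear (c.totalInput m₁ m₂) y) = y :=
  c.received_eq_of_forall m₁ m₂ fun t => by rw [shear]; ring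

theorem measurable_output : ∀ (t : ℕ) (ht : t ≤ n), Measurable fun z => c.output m₁ m₂ z t ht
  | 0, _ => measurable_pi_lambda _ fun i => i.elim0
  | t + 1, ht => by
    have ih := measurable_output t (Nat.le_of_succ_le ht)
    refine measurable_pi_lambda _ fun i => ?_
    refine Fin.lastCases ?_ (fun j => ?_) i
    · simp only [output, Fin.snoc_last]
      exact (((c.measurable_enc₁ _ m₁).comp ih).add ((c.measurable_enc₂ _ m₂).comp ih)).add
        (measurable_pi_apply _)
    · simp only [output, Fin.snoc_castSucc]
      exact (measurable_pi_apply j).comp ih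

theorem measurable_received : Measurable (c.received m₁ m₂) := c.measurable_output m₁ m₂ n le_rfl

theorem output_congr {z z' : Fin n → ℝ} : ∀ (t : ℕ) (ht : t ≤ n),
    (∀ i : Fin n, (i : ℕ) < t → z i = z' i) → c.output m₁ m₂ z t ht = c.output m₁ m₂ z' t ht
  | 0, _, _ => rfl
  | t + 1, ht, h => by
    rw [output, output, output_congr t _ fun i hi => h i (by omega), h ⟨t, ht⟩ (by simp)]

theorem measurable_input₁ (t : Fin n) : Measurable fun z => c.input₁ m₁ m₂ z t :=
  (c.measurable_enc₁ t m₁).comp (c.measurable_output m₁ m₂ t _)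

theorem measurable_input₂ (t : Fin n) : Measurable fun z => c.input₂ m₁ m₂ z t :=
  (c.measurable_enc₂ t m₂).comp (c.measurable_output m₁ m₂ t _)

theorem output_update (z : Fin n → ℝ) (t : Fin n) (x : ℝ) :
    c.output m₁ m₂ (Function.update z t x) t t.isLt.le = c.output m₁ m₂ z t t.isLt.le :=
  c.output_congr m₁ m₂ t _ fun i hi => Function.update_of_ne (fun h => by simp [h] at hi) _ _

end FeedbackCode

/-! ### Moments of the noise -/

theorem integral_sq_linearCombination {Ω : Type*} [MeasurableSpace Ω] {μ : Measure Ω}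
    {X Y : Ω → ℝ} (hX : MemLp X 2 μ) (hY : MemLp Y 2 μ) (α β : ℝ) :
    ∫ ω, (α * X ω + β * Y ω) ^ 2 ∂μ =
      α ^ 2 * ∫ ω, X ω ^ 2 ∂μ + 2 * α * β * ∫ ω, X ω * Y ω ∂μ + β ^ 2 * ∫ ω, Y ω ^ 2 ∂μ := by
  have hXX := hX.integrable_sq.const_mul (α ^ 2)
  have hXY : Integrable (fun ω => 2 * α * β * (X ω * Y ω)) μ :=
    (hX.integrable_mul hY).const_mul _
  have hYY := hY.integrable_sq.const_mul (β ^ 2)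
  calc ∫ ω, (α * X ω + β * Y ω) ^ 2 ∂μ
      = ∫ ω, (α ^ 2 * X ω ^ 2 + 2 * α * β * (X ω * Y ω) + β ^ 2 * Y ω ^ 2) ∂μ := by
        congr with ω
        ring
    _ = _ := by
        rw [integral_add (f := fun ω => α ^ 2 * X ω ^ 2 + 2 * α * β * (X ω * Y ω))
          (hXX.add hXY) hYY, integral_add hXX hXY, integral_const_mul, integral_const_mul,
          integral_const_mul]

section Noise

variable {n : ℕ}

theorem measurePreserving_flip (N : ℝ) (t : Fin n) :
    MeasurePreserving (fun z : Fin n → ℝ => Function.update z t (-z t))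
      (noiseLaw n N) (noiseLaw n N) := by
  have h := measurePreserving_pi (fun _ : Fin n => gaussianReal 0 N.toNNReal)
    (fun _ : Fin n => gaussianReal 0 N.toNNReal) (f := fun i x => if i = t then -x else x) (by
      intro i
      by_cases hi : i = t
      · simp only [hi, if_true]
        exact ⟨measurable_neg, by simpa using gaussianReal_map_neg (μ := 0) (v := N.toNNReal)⟩
      · simp only [hi, if_false]
        exact MeasurePreserving.id _)
  have hfun : (fun z : Fin n → ℝ => Function.update z t (-z t)) =
      fun z i => if i = t then -z i else z i := by
    funext z i
    by_cases hi : i = t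
    · subst hi
      simp
    · simp [hi]
  rw [hfun]
  exact h

theorem memLp_noise (N : ℝ) (t : Fin n) : MemLp (fun z : Fin n → ℝ => z t) 2 (noiseLaw n N) :=
  (memLp_id_gaussianReal' (μ := 0) (v := N.toNNReal) 2 (by simp)).comp_measurePreserving
    (measurePreserving_eval (fun _ : Fin n => gaussianReal 0 N.toNNReal) t)

theorem integral_noise_sq {N : ℝ} (hN : 0 < N) (t : Fin n) :
    ∫ z, z t ^ 2 ∂noiseLaw n N = N := by
  have h := variance_fun_id_gaussianReal (μ := 0) (v := N.toNNReal)
  rw [variance_eq_integral aemeasurable_id'] at h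
  simp only [integral_id_gaussianReal, sub_zero, Real.coe_toNNReal _ hN.le] at h
  refine Eq.trans ?_ h
  exact integral_comp_eval (μ := fun _ : Fin n => gaussianReal 0 N.toNNReal) (i := t)
    (f := fun x : ℝ => x ^ 2) (by fun_prop)

theorem integral_mul_noise_eq_zero (N : ℝ) (t : Fin n) {D : (Fin n → ℝ) → ℝ} (hD : Measurable D)
    (hf : ∀ z, D (Function.update z t (-z t)) = D z) :
    ∫ z, D z * z t ∂noiseLaw n N = 0 := by
  have hm : Measurable fun z : Fin n → ℝ => D z * z t := hD.mul (measurable_pi_apply t)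
  have hmp := measurePreserving_flip (n := n) N t
  have h := integral_map (μ := noiseLaw n N) hmp.measurable.aemeasurable
    (f := fun z => D z * z t) hm.aestronglyMeasurable
  rw [hmp.map_eq] at h
  simp only [hf, Function.update_self, mul_neg, integral_neg] at h
  linarith

theorem integral_add_noise_sq {N : ℝ} (hN : 0 < N) (t : Fin n) {D : (Fin n → ℝ) → ℝ}
    (hD : Measurable D) (hD2 : MemLp D 2 (noiseLaw n N))
    (hflip : ∀ z, D (Function.update z t (-z t)) = D z) :
    ∫ z, (D z + z t) ^ 2 ∂noiseLaw n N = ∫ z, D z ^ 2 ∂noiseLaw n N + N := by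
  have h := integral_sq_linearCombination hD2 (memLp_noise N t) 1 1
  simpa only [one_mul, one_pow, mul_one, integral_mul_noise_eq_zero N t hD hflip, mul_zero,
    add_zero, integral_noise_sq hN] using h

section LogRatio

variable {N s : ℝ} {u : (Fin n → ℝ) → Fin n → ℝ}

theorem integrable_logRatio_term (hu : ∀ t, MemLp (fun z => u z t) 2 (noiseLaw n N)) (t : Fin n) :
    Integrable (fun z => 1 / 2 * Real.log (s / N) + u z t ^ 2 / (2 * s) - z t ^ 2 / (2 * N))
      (noiseLaw n N) :=
  ((integrable_const _).add ((hu t).integrable_sq.div_const _)).sub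
    ((memLp_noise N t).integrable_sq.div_const _)

theorem integrable_logRatio (hu : ∀ t, MemLp (fun z => u z t) 2 (noiseLaw n N)) :
    Integrable (fun z => logRatio N s (u z) z) (noiseLaw n N) :=
  integrable_finsetSum _ fun t _ => integrable_logRatio_term hu t

theorem integral_logRatio (hN : 0 < N) (hs : 0 < s)
    (hu : ∀ t, MemLp (fun z => u z t) 2 (noiseLaw n N)) :
    ∫ z, logRatio N s (u z) z ∂noiseLaw n N =
      n / 2 * Real.log (s / N) + (∑ t, ∫ z, u z t ^ 2 ∂noiseLaw n N - n * s) / (2 * s) := by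
  have hterm (t : Fin n) :
      ∫ z, (1 / 2 * Real.log (s / N) + u z t ^ 2 / (2 * s) - z t ^ 2 / (2 * N)) ∂noiseLaw n N =
        1 / 2 * Real.log (s / N) + (∫ z, u z t ^ 2 ∂noiseLaw n N) / (2 * s) - 1 / 2 := by
    have husq := (hu t).integrable_sq.div_const (2 * s)
    have hleft : Integrable (fun z => 1 / 2 * Real.log (s / N) + u z t ^ 2 / (2 * s))
        (noiseLaw n N) := (integrable_const _).add husq
    rw [integral_sub hleft ((memLp_noise N t).integrable_sq.div_const _),
      integral_add (integrable_const _) husq, integral_div, integral_div, integral_noise_sq hN,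
      integral_const, probReal_univ, one_smul]
    congr 1
    field_simp
  simp only [logRatio]
  rw [integral_finsetSum _ fun t _ => integrable_logRatio_term hu t]
  simp only [hterm, sum_sub_distrib, sum_add_distrib, sum_const, card_univ, Fintype.card_fin,
    nsmul_eq_mul, ← sum_div]
  field_simp
  ring

end LogRatio

end Noise

/-! ### The converse for perfect feedback -/

namespace FeedbackCode

variable {n : ℕ} (c : FeedbackCode n)

/-- The linear combination `α X₁ + β X₂` of the channel inputs. -/
def mixedInput (α β : ℝ) (m : Fin c.M₁ × Fin c.M₂) (z : Fin n → ℝ) (t : Fin n) : ℝ :=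
  α * c.input₁ m.1 m.2 z t + β * c.input₂ m.1 m.2 z t

/-- The conditional mean of the outputs under the auxiliary law for which the innovation is
`α X₁ + β X₂ + Z`. -/
def center (α β : ℝ) (m : Fin c.M₁ × Fin c.M₂) (t : Fin n) (p : Fin t → ℝ) : ℝ :=
  (1 - α) * c.enc₁ t m.1 p + (1 - β) * c.enc₂ t m.2 p

/-- All channel inputs have finite second moments under noise of variance `N`, so that the
energies below are not junk values of the integral. -/
def FiniteEnergy (N : ℝ) : Prop :=
  ∀ m₁ m₂ t, MemLp (fun z => c.input₁ m₁ m₂ z t) 2 (noiseLaw n N) ∧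
    MemLp (fun z => c.input₂ m₁ m₂ z t) 2 (noiseLaw n N)

/-- The sum over messages and times of `E[(α X₁ + β X₂)²]`. -/
def energy (N α β : ℝ) : ℝ := ∑ m, ∑ t, ∫ z, c.mixedInput α β m z t ^ 2 ∂noiseLaw n N

/-- The sum over messages and times of `E[X₁ X₂]`. -/
def crossEnergy (N : ℝ) : ℝ :=
  ∑ m : Fin c.M₁ × Fin c.M₂, ∑ t,
    ∫ z, c.input₁ m.1 m.2 z t * c.input₂ m.1 m.2 z t ∂noiseLaw n N

theorem shear_totalInput_received (m₁ : Fin c.M₁) (m₂ : Fin c.M₂) (z : Fin n → ℝ) :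
    shear (c.totalInput m₁ m₂) (c.received m₁ m₂ z) = z := by
  funext t
  rw [shear, past_received, received_apply, add_sub_cancel_left]

theorem shear_center_received (α β : ℝ) (m : Fin c.M₁ × Fin c.M₂) (z : Fin n → ℝ) :
    shear (c.center α β m) (c.received m.1 m.2 z) = fun t => c.mixedInput α β m z t + z t := by
  funext t
  rw [shear, past_received, received_apply, center, totalInput, mixedInput, input₁, input₂]
  ring

theorem measurable_mixedInput (α β : ℝ) (m : Fin c.M₁ × Fin c.M₂) (t : Fin n) :
    Measurable fun z => c.mixedInput α β m z t :=
  ((c.measurable_input₁ m.1 m.2 t).const_mul α).add ((c.measurable_input₂ m.1 m.2 t).const_mul β)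

theorem measurable_center (α β : ℝ) (m : Fin c.M₁ × Fin c.M₂) (t : Fin n) :
    Measurable (c.center α β m t) :=
  ((c.measurable_enc₁ t m.1).const_mul (1 - α)).add ((c.measurable_enc₂ t m.2).const_mul (1 - β))

theorem measurable_logRatio_center (N s α β : ℝ) (m : Fin c.M₁ × Fin c.M₂) :
    Measurable fun y => logRatio N s (shear (c.center α β m) y)
      (shear (c.totalInput m.1 m.2) y) :=
  measurable_logRatio N s (measurable_shear (c.measurable_center α β m))
    (measurable_shear (c.measurable_totalInput m.1 m.2))

theorem card_pos : 0 < c.M₁ ∧ 0 < c.M₂ := ⟨(c.dec 0).1.pos, (c.dec 0).2.pos⟩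

theorem measurableSet_dec_preimage (S : Set (Fin c.M₁ × Fin c.M₂)) : MeasurableSet (c.dec ⁻¹' S) :=
  c.measurable_dec (Set.toFinite S).measurableSet

variable {N : ℝ}

theorem map_received (hN : 0 < N) (m₁ : Fin c.M₁) (m₂ : Fin c.M₂) :
    (noiseLaw n N).map (c.received m₁ m₂) = causalGaussian N (c.totalInput m₁ m₂) :=
  map_noiseLaw_eq_causalGaussian hN (c.measurable_totalInput m₁ m₂)
    (c.measurable_received m₁ m₂) (c.received_shear m₁ m₂)

theorem sum_prob_correct (N : ℝ) :
    ∑ m, (noiseLaw n N).real (c.received m.1 m.2 ⁻¹' (c.dec ⁻¹' {m})) =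
      (c.M₁ : ℝ) * c.M₂ * (1 - c.errorProb N) := by
  obtain ⟨h₁, h₂⟩ := c.card_pos
  have hcompl (m : Fin c.M₁ × Fin c.M₂) :
      (noiseLaw n N).real (c.received m.1 m.2 ⁻¹' (c.dec ⁻¹' {m})) =
        1 - (noiseLaw n N).real {z | c.dec (c.output m.1 m.2 z n le_rfl) ≠ m} := by
    have hmeas : MeasurableSet {z | c.dec (c.output m.1 m.2 z n le_rfl) ≠ m} :=
      c.measurable_received m.1 m.2 (c.measurableSet_dec_preimage {p | p ≠ m})
    rw [← probReal_compl_eq_one_sub hmeas]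
    congr 1
    ext z
    simp [received]
  have : ((c.M₁ : ℝ) * c.M₂) ≠ 0 := by positivity
  simp only [hcompl, sum_sub_distrib, sum_const, card_univ, Fintype.card_prod, Fintype.card_fin,
    nsmul_eq_mul, mul_one, errorProb, Fintype.sum_prod_type, Nat.cast_mul]
  field_simp

section FiniteEnergy

variable {c}

theorem FiniteEnergy.memLp_mixedInput (hc : c.FiniteEnergy N) (α β : ℝ)
    (m : Fin c.M₁ × Fin c.M₂) (t : Fin n) :
    MemLp (fun z => c.mixedInput α β m z t) 2 (noiseLaw n N) :=
  ((hc m.1 m.2 t).1.const_mul α).add ((hc m.1 m.2 t).2.const_mul β)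

theorem FiniteEnergy.energy_eq (hc : c.FiniteEnergy N) (α β : ℝ) :
    c.energy N α β =
      α ^ 2 * c.energy N 1 0 + 2 * α * β * c.crossEnergy N + β ^ 2 * c.energy N 0 1 := by
  simp only [energy, crossEnergy, mixedInput, mul_sum, ← sum_add_distrib, one_mul, zero_mul,
    add_zero, zero_add]
  exact sum_congr rfl fun m _ => sum_congr rfl fun t _ =>
    integral_sq_linearCombination (hc m.1 m.2 t).1 (hc m.1 m.2 t).2 α β

theorem FiniteEnergy.integrable_logRatio_center (hc : c.FiniteEnergy N) (hN : 0 < N) (s α β : ℝ)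
    (m : Fin c.M₁ × Fin c.M₂) :
    Integrable (fun y => logRatio N s (shear (c.center α β m) y)
      (shear (c.totalInput m.1 m.2) y)) (causalGaussian N (c.totalInput m.1 m.2)) := by
  rw [← c.map_received hN, integrable_map_measure
    (c.measurable_logRatio_center N s α β m).aestronglyMeasurable
    (c.measurable_received m.1 m.2).aemeasurable]
  simp only [Function.comp_def, shear_center_received, shear_totalInput_received]
  exact integrable_logRatio fun t => (hc.memLp_mixedInput α β m t).add (memLp_noise N t)

theorem FiniteEnergy.integral_logRatio_center (hc : c.FiniteEnergy N) (hN : 0 < N) {s : ℝ}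
    (hs : 0 < s) (α β : ℝ) (m : Fin c.M₁ × Fin c.M₂) :
    ∫ y, logRatio N s (shear (c.center α β m) y) (shear (c.totalInput m.1 m.2) y)
        ∂causalGaussian N (c.totalInput m.1 m.2) =
      n / 2 * Real.log (s / N) +
        (∑ t, ∫ z, c.mixedInput α β m z t ^ 2 ∂noiseLaw n N - n * (s - N)) / (2 * s) := by
  have hX := hc.memLp_mixedInput α β m
  have hsq (t : Fin n) : ∫ z, (c.mixedInput α β m z t + z t) ^ 2 ∂noiseLaw n N =
      ∫ z, c.mixedInput α β m z t ^ 2 ∂noiseLaw n N + N :=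
    integral_add_noise_sq hN t (c.measurable_mixedInput α β m t) (hX t)
      fun z => by simp only [mixedInput, input₁, input₂, output_update]
  rw [← c.map_received hN, integral_map (c.measurable_received m.1 m.2).aemeasurable
    (c.measurable_logRatio_center N s α β m).aestronglyMeasurable]
  simp only [shear_center_received, shear_totalInput_received]
  rw [integral_logRatio (u := fun z t => c.mixedInput α β m z t + z t) hN hs
    fun t => (hX t).add (memLp_noise N t)]
  simp only [hsq, sum_add_distrib, sum_const, card_univ, Fintype.card_fin, nsmul_eq_mul]
  ring

theorem FiniteEnergy.log_card_mul_sum_prob_le (hc : c.FiniteEnergy N) (hN : 0 < N) {s : ℝ}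
    (hs : 0 < s) (α β : ℝ) {ι : Type*} [Fintype ι] [Nonempty ι] {m : ι → Fin c.M₁ × Fin c.M₂}
    (hm : Function.Injective m) (hcenter : ∀ i j, c.center α β (m i) = c.center α β (m j)) :
    Real.log (Fintype.card ι) *
        ∑ i, (noiseLaw n N).real (c.received (m i).1 (m i).2 ⁻¹' (c.dec ⁻¹' {m i})) ≤
      ∑ i, (n / 2 * Real.log (s / N) + (∑ t, ∫ z, c.mixedInput α β (m i) z t ^ 2 ∂noiseLaw n N -
        n * (s - N)) / (2 * s)) + Fintype.card ι := by
  obtain ⟨i₀⟩ := ‹Nonempty ι›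
  have hinput := fun i => c.measurable_totalInput (m i).1 (m i).2
  have hconst (i : ι) : c.center α β (m i) = c.center α β (m i₀) := hcenter i i₀
  have := isProbabilityMeasure_causalGaussian hs (c.measurable_center α β (m i₀))
  have := fun i => isProbabilityMeasure_causalGaussian hN (hinput i)
  have hE (i : ι) : MeasurableSet (c.dec ⁻¹' {m i}) := c.measurableSet_dec_preimage _
  have hlaw (i : ι) : (noiseLaw n N).real (c.received (m i).1 (m i).2 ⁻¹' (c.dec ⁻¹' {m i})) =
      (causalGaussian N (c.totalInput (m i).1 (m i).2)).real (c.dec ⁻¹' {m i}) := by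
    rw [← c.map_received hN, map_measureReal_apply (c.measurable_received _ _) (hE i)]
  simp only [hlaw, ← hc.integral_logRatio_center hN hs α β]
  exact log_card_mul_sum_measureReal_le
    (fun i => hc.integrable_logRatio_center hN s α β (m i))
    (ν := causalGaussian s (c.center α β (m i₀)))
    (fun i => (causalGaussian_withDensity hN hs (c.measurable_center α β (m i))
      (hinput i)).trans (congrArg (causalGaussian s) (hconst i))) hE
    fun i j hij => (Set.disjoint_singleton.2 (hm.ne hij)).preimage _

theorem FiniteEnergy.one_sub_errorProb_mul_log_card_le (hc : c.FiniteEnergy N) (hN : 0 < N) {s : ℝ}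
    (hs : 0 < s) {α β : ℝ} {κ ι : Type*} [Finite κ] [Fintype ι] [Nonempty ι]
    (e : κ × ι ≃ Fin c.M₁ × Fin c.M₂)
    (hcenter : ∀ k i j, c.center α β (e (k, i)) = c.center α β (e (k, j)))
    (henergy : c.energy N α β ≤ n * (c.M₁ * c.M₂) * (s - N)) :
    (1 - c.errorProb N) * Real.log (Fintype.card ι) ≤ n / 2 * Real.log (s / N) + 1 := by
  have := Fintype.ofFinite κ
  obtain ⟨h₁, h₂⟩ := c.card_pos
  have hpos : (0 : ℝ) < c.M₁ * c.M₂ := by positivity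
  have hcard : (Fintype.card κ * Fintype.card ι : ℝ) = c.M₁ * c.M₂ := by
    have := Fintype.card_congr e
    simp only [Fintype.card_prod, Fintype.card_fin] at this
    exact_mod_cast this
  have hsum := sum_le_sum fun k (_ : k ∈ univ) => hc.log_card_mul_sum_prob_le hN hs α β
    (fun i j h => (Prod.mk.inj (e.injective h)).2) (hcenter k)
  have hreindex (f : Fin c.M₁ × Fin c.M₂ → ℝ) : ∑ k, ∑ i, f (e (k, i)) = ∑ m, f m := by
    rw [← Fintype.sum_prod_type', e.sum_comp]
  have hleft := hreindex fun m => (noiseLaw n N).real (c.received m.1 m.2 ⁻¹' (c.dec ⁻¹' {m}))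
  have hright := hreindex fun m => n / 2 * Real.log (s / N) +
    (∑ t, ∫ z, c.mixedInput α β m z t ^ 2 ∂noiseLaw n N - n * (s - N)) / (2 * s)
  rw [← mul_sum, hleft, sum_prob_correct, sum_add_distrib, hright, sum_add_distrib, ← sum_div,
    sum_sub_distrib] at hsum
  simp only [sum_const, card_univ, Fintype.card_prod, Fintype.card_fin, nsmul_eq_mul,
    Nat.cast_mul, hcard] at hsum
  have hslack : (c.energy N α β - c.M₁ * c.M₂ * (n * (s - N))) / (2 * s) ≤ 0 :=
    div_nonpos_of_nonpos_of_nonneg (by linarith) (by positivity)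
  rw [energy] at hslack
  refine le_of_mul_le_mul_left ?_ hpos
  linarith

end FiniteEnergy

theorem energy_nonneg (N α β : ℝ) : 0 ≤ c.energy N α β :=
  sum_nonneg fun _ _ => sum_nonneg fun _ _ => integral_nonneg fun _ => sq_nonneg _

end FeedbackCode

theorem exists_residual_le {V p p' q ρ e e' : ℝ} (hp' : 0 < p') (he : e ≤ V * p ^ 2)
    (he' : e' ≤ V * p' ^ 2) (hq : ρ * q = V * (p * p') * ρ ^ 2) :
    ∃ β, e + 2 * β * q + β ^ 2 * e' ≤ V * (p ^ 2 * (1 - ρ ^ 2)) := by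
  refine ⟨-(ρ * (p / p')), ?_⟩
  have hsq : (-(ρ * (p / p'))) ^ 2 * e' ≤ V * p ^ 2 * ρ ^ 2 :=
    calc (-(ρ * (p / p'))) ^ 2 * e' ≤ (-(ρ * (p / p'))) ^ 2 * (V * p' ^ 2) := by gcongr
      _ = V * p ^ 2 * ρ ^ 2 := by field_simp
  have hcross : -(ρ * (p / p')) * q = -(V * p ^ 2 * ρ ^ 2) :=
    calc -(ρ * (p / p')) * q = -(p / p') * (ρ * q) := by ring
      _ = -(V * p ^ 2 * ρ ^ 2) := by rw [hq]; field_simp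
  linarith

theorem exists_correlation_of_sq {e₁ e₂ q V p₁ p₂ : ℝ} (hV : 0 < V) (hp₁ : 0 < p₁) (hp₂ : 0 < p₂)
    (hform : 0 ≤ p₂ ^ 2 * e₁ - 2 * p₂ * p₁ * q + p₁ ^ 2 * e₂)
    (he₁ : e₁ ≤ V * p₁ ^ 2) (he₂ : e₂ ≤ V * p₂ ^ 2) :
    ∃ ρ ∈ Set.Icc (0 : ℝ) 1, ρ * q = V * (p₁ * p₂) * ρ ^ 2 ∧ q ≤ V * (p₁ * p₂) * ρ := by
  have hW : 0 < V * (p₁ * p₂) := by positivity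
  have hq : q ≤ V * (p₁ * p₂) := by
    have h₁ := mul_le_mul_of_nonneg_left he₁ (sq_nonneg p₂)
    have h₂ := mul_le_mul_of_nonneg_left he₂ (sq_nonneg p₁)
    refine le_of_mul_le_mul_left (a := p₁ * p₂) ?_ (by positivity)
    linarith
  rcases le_total q 0 with h | h
  · exact ⟨0, ⟨le_rfl, zero_le_one⟩, by ring, by simpa only [mul_zero] using h⟩
  · refine ⟨q / (V * (p₁ * p₂)), ⟨div_nonneg h hW.le, (div_le_one hW).2 hq⟩, ?_, ?_⟩
    · field_simp
    · rw [mul_div_cancel₀ _ hW.ne']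

/-- `ρ` is the positive part of the empirical correlation coefficient of the two inputs, and the
residuals are those of estimating one input linearly from the other. -/
theorem exists_correlation {e₁ e₂ q V P₁ P₂ : ℝ} (hV : 0 < V) (hP₁ : 0 < P₁) (hP₂ : 0 < P₂)
    (hform : ∀ α β, 0 ≤ α ^ 2 * e₁ + 2 * α * β * q + β ^ 2 * e₂)
    (he₁ : e₁ ≤ V * P₁) (he₂ : e₂ ≤ V * P₂) :
    ∃ ρ ∈ Set.Icc (0 : ℝ) 1,
      (∃ β, e₁ + 2 * β * q + β ^ 2 * e₂ ≤ V * (P₁ * (1 - ρ ^ 2))) ∧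
      (∃ α, α ^ 2 * e₁ + 2 * α * q + e₂ ≤ V * (P₂ * (1 - ρ ^ 2))) ∧
      e₁ + 2 * q + e₂ ≤ V * (P₁ + P₂ + 2 * √(P₁ * P₂) * ρ) := by
  have hp₁ := Real.sqrt_pos.2 hP₁
  have hp₂ := Real.sqrt_pos.2 hP₂
  rw [← Real.sq_sqrt hP₁.le] at he₁
  rw [← Real.sq_sqrt hP₂.le] at he₂
  obtain ⟨ρ, hρ, hq, hle⟩ := exists_correlation_of_sq (q := q) hV hp₁ hp₂
    (by linarith [hform (√P₂) (-√P₁)]) he₁ he₂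
  obtain ⟨β, hβ⟩ := exists_residual_le hp₂ he₁ he₂ hq
  obtain ⟨α, hα⟩ := exists_residual_le hp₁ he₂ he₁ (by rw [hq]; ring)
  rw [Real.sq_sqrt hP₁.le] at he₁ hβ
  rw [Real.sq_sqrt hP₂.le] at he₂ hα
  refine ⟨ρ, hρ, ⟨β, hβ⟩, ⟨α, by linarith⟩, ?_⟩
  rw [Real.sqrt_mul hP₁.le]
  linarith

namespace FeedbackCode

variable {n : ℕ} (c : FeedbackCode n) {N : ℝ}

theorem sum_le_of_powerConstraint {P : ℝ} (hn : 0 < n)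
    {X : Fin c.M₁ → Fin c.M₂ → (Fin n → ℝ) → Fin n → ℝ} (h : c.PowerConstraint N P X) :
    ∑ m : Fin c.M₁ × Fin c.M₂, ∑ t, ∫ z, X m.1 m.2 z t ^ 2 ∂noiseLaw n N ≤
      n * (c.M₁ * c.M₂) * P := by
  obtain ⟨h₁, h₂⟩ := c.card_pos
  have h := h.2
  rw [← mul_sum, ← mul_assoc, div_mul_div_comm, one_mul, div_mul_eq_mul_div, one_mul,
    div_le_iff₀ (by positivity), mul_comm P] at h
  rw [sum_comm]
  simpa only [Fintype.sum_prod_type] using h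

theorem finiteEnergy_of_powerConstraint {P₁ P₂ : ℝ} (h₁ : c.PowerConstraint N P₁ c.input₁)
    (h₂ : c.PowerConstraint N P₂ c.input₂) : c.FiniteEnergy N := fun m₁ m₂ t =>
  ⟨(memLp_two_iff_integrable_sq (c.measurable_input₁ m₁ m₂ t).aestronglyMeasurable).2
      (h₁.1 m₁ m₂ t),
    (memLp_two_iff_integrable_sq (c.measurable_input₂ m₁ m₂ t).aestronglyMeasurable).2
      (h₂.1 m₁ m₂ t)⟩

variable {c} {x : ℝ}

theorem FiniteEnergy.one_sub_errorProb_mul_log_card_le₁ (hc : c.FiniteEnergy N) (hN : 0 < N)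
    (hx : 0 ≤ x) {β : ℝ} (h : c.energy N 1 β ≤ n * (c.M₁ * c.M₂) * x) :
    (1 - c.errorProb N) * Real.log c.M₁ ≤ n / 2 * Real.log (1 + x / N) + 1 := by
  have : Nonempty (Fin c.M₁) := ⟨⟨0, c.card_pos.1⟩⟩
  have hbound := hc.one_sub_errorProb_mul_log_card_le hN (s := N + x) (by positivity)
    (α := 1) (β := β) (Equiv.prodComm (Fin c.M₂) (Fin c.M₁))
    (fun k i j => by
      funext t p
      simp only [center, Equiv.prodComm_apply, Prod.swap_prod_mk, sub_self, zero_mul])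
    (by rwa [add_sub_cancel_left])
  rwa [Fintype.card_fin, add_div, div_self hN.ne'] at hbound

theorem FiniteEnergy.one_sub_errorProb_mul_log_card_le₂ (hc : c.FiniteEnergy N) (hN : 0 < N)
    (hx : 0 ≤ x) {α : ℝ} (h : c.energy N α 1 ≤ n * (c.M₁ * c.M₂) * x) :
    (1 - c.errorProb N) * Real.log c.M₂ ≤ n / 2 * Real.log (1 + x / N) + 1 := by
  have : Nonempty (Fin c.M₂) := ⟨⟨0, c.card_pos.2⟩⟩
  have hbound := hc.one_sub_errorProb_mul_log_card_le hN (s := N + x) (by positivity)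
    (α := α) (β := 1) (Equiv.refl (Fin c.M₁ × Fin c.M₂))
    (fun k i j => by
      funext t p
      simp only [center, Equiv.refl_apply, sub_self, zero_mul])
    (by rwa [add_sub_cancel_left])
  rwa [Fintype.card_fin, add_div, div_self hN.ne'] at hbound

theorem FiniteEnergy.one_sub_errorProb_mul_log_card_add_le (hc : c.FiniteEnergy N) (hN : 0 < N)
    (hx : 0 ≤ x) (h : c.energy N 1 1 ≤ n * (c.M₁ * c.M₂) * x) :
    (1 - c.errorProb N) * (Real.log c.M₁ + Real.log c.M₂) ≤
      n / 2 * Real.log (1 + x / N) + 1 := by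
  obtain ⟨h₁, h₂⟩ := c.card_pos
  have : Nonempty (Fin c.M₁ × Fin c.M₂) := ⟨⟨⟨0, h₁⟩, ⟨0, h₂⟩⟩⟩
  have hbound := hc.one_sub_errorProb_mul_log_card_le hN (s := N + x) (by positivity)
    (α := 1) (β := 1) (Equiv.punitProd (Fin c.M₁ × Fin c.M₂))
    (fun (_ : Unit) i j => by
      funext t p
      simp only [center, sub_self, zero_mul])
    (by rwa [add_sub_cancel_left])
  rwa [Fintype.card_prod, Fintype.card_fin, Fintype.card_fin, Nat.cast_mul,
    Real.log_mul (by positivity) (by positivity), add_div, div_self hN.ne'] at hbound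

theorem exists_one_sub_errorProb_mul_log_card_le {P₁ P₂ : ℝ} (hP₁ : 0 < P₁) (hP₂ : 0 < P₂)
    (hN : 0 < N) (hn : 0 < n) (h₁ : c.PowerConstraint N P₁ c.input₁)
    (h₂ : c.PowerConstraint N P₂ c.input₂) :
    ∃ ρ ∈ Set.Icc (0 : ℝ) 1,
      (1 - c.errorProb N) * Real.log c.M₁ ≤
        n / 2 * Real.log (1 + P₁ * (1 - ρ ^ 2) / N) + 1 ∧
      (1 - c.errorProb N) * Real.log c.M₂ ≤
        n / 2 * Real.log (1 + P₂ * (1 - ρ ^ 2) / N) + 1 ∧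
      (1 - c.errorProb N) * (Real.log c.M₁ + Real.log c.M₂) ≤
        n / 2 * Real.log (1 + (P₁ + P₂ + 2 * √(P₁ * P₂) * ρ) / N) + 1 := by
  obtain ⟨hM₁, hM₂⟩ := c.card_pos
  have hc := c.finiteEnergy_of_powerConstraint h₁ h₂
  have he₁ : c.energy N 1 0 ≤ n * (c.M₁ * c.M₂) * P₁ := by
    simpa only [energy, mixedInput, one_mul, zero_mul, add_zero] using
      c.sum_le_of_powerConstraint hn h₁
  have he₂ : c.energy N 0 1 ≤ n * (c.M₁ * c.M₂) * P₂ := by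
    simpa only [energy, mixedInput, one_mul, zero_mul, zero_add] using
      c.sum_le_of_powerConstraint hn h₂
  obtain ⟨ρ, hρ, ⟨β, hβ⟩, ⟨α, hα⟩, hsum⟩ := exists_correlation (by positivity) hP₁ hP₂
    (fun α β => hc.energy_eq α β ▸ c.energy_nonneg N α β) he₁ he₂
  have hsq : 0 ≤ 1 - ρ ^ 2 := sub_nonneg.2 (pow_le_one₀ hρ.1 hρ.2)
  have hρ0 := hρ.1
  refine ⟨ρ, hρ, hc.one_sub_errorProb_mul_log_card_le₁ hN (by positivity) (β := β) ?_,
    hc.one_sub_errorProb_mul_log_card_le₂ hN (by positivity) (α := α) ?_,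
    hc.one_sub_errorProb_mul_log_card_add_le hN (by positivity) ?_⟩ <;>
  rw [hc.energy_eq] <;> linarith

end FeedbackCode

theorem exists_mem_forall_le_of_forall_pos {X ι : Type*} [TopologicalSpace X] [T2Space X]
    {K : Set X} (hK : IsCompact K) {f : ι → X → ℝ} (hf : ∀ i, ContinuousOn (f i) K) {r : ι → ℝ}
    (h : ∀ ε > 0, ∃ x ∈ K, ∀ i, r i ≤ f i x + ε) : ∃ x ∈ K, ∀ i, r i ≤ f i x := by
  let S (ε : Set.Ioi (0 : ℝ)) : Set X := K ∩ ⋂ i, K ∩ f i ⁻¹' Set.Ici (r i - ε)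
  have hmem {ε : Set.Ioi (0 : ℝ)} {x : X} : x ∈ S ε ↔ x ∈ K ∧ ∀ i, r i ≤ f i x + ε := by
    simp only [S, Set.mem_inter_iff, Set.mem_iInter, Set.mem_preimage, Set.mem_Ici,
      sub_le_iff_le_add]
    exact and_congr_right fun hx => forall_congr' fun i => and_iff_right hx
  have hclosed (ε : Set.Ioi (0 : ℝ)) : IsClosed (S ε) := hK.isClosed.inter <|
    isClosed_iInter fun i => (hf i).preimage_isClosed_of_isClosed hK.isClosed isClosed_Ici
  have hmono {ε ε' : Set.Ioi (0 : ℝ)} (hε : ε ≤ ε') : S ε ⊆ S ε' := fun x hx =>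
    hmem.2 ⟨hx.1, fun i => ((hmem.1 hx).2 i).trans (by gcongr)⟩
  have hone : (1 : ℝ) ∈ Set.Ioi 0 := Set.mem_Ioi.2 one_pos
  have : Nonempty (Set.Ioi (0 : ℝ)) := ⟨⟨1, hone⟩⟩
  obtain ⟨x, hx⟩ := IsCompact.nonempty_iInter_of_directed_nonempty_isCompact_isClosed S
    (fun ε ε' => ⟨ε ⊓ ε', hmono inf_le_left, hmono inf_le_right⟩)
    (fun ε => (h ε ε.2).imp fun x hx => hmem.2 hx)
    (fun ε => hK.of_isClosed_subset (hclosed ε) Set.inter_subset_left) hclosed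
  rw [Set.mem_iInter] at hx
  exact ⟨x, (hx ⟨1, hone⟩).1, fun i =>
    le_of_forall_pos_le_add fun ε hε => (hmem.1 (hx ⟨ε, hε⟩)).2 i⟩

theorem le_half_add_of_one_sub_mul_le {r L U δ e n : ℝ} (hn : 0 < n) (hnδ : 1 / n ≤ δ)
    (hδ : δ ≤ 1) (he : e ≤ δ) (hL : 0 ≤ L) (hr : r - 2 * δ ≤ 1 / n * L)
    (hU : (1 - e) * L ≤ n / 2 * U + 1) : r ≤ 1 / 2 * U + δ * (r + 3) := by
  have hchain : (1 - δ) * (r - 2 * δ) ≤ 1 / 2 * U + δ :=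
    calc (1 - δ) * (r - 2 * δ) ≤ (1 - δ) * (1 / n * L) :=
          mul_le_mul_of_nonneg_left hr (sub_nonneg.2 hδ)
      _ = 1 / n * ((1 - δ) * L) := by ring
      _ ≤ 1 / n * ((1 - e) * L) := by gcongr
      _ ≤ 1 / n * (n / 2 * U + 1) := by gcongr
      _ = 1 / 2 * U + 1 / n := by field_simp
      _ ≤ 1 / 2 * U + δ := by gcongr
  linarith [sq_nonneg δ]

section Converse

variable {P₁ P₂ N : ℝ} {R : ℝ × ℝ}

theorem exists_forall_le_ozarow_add (hP₁ : 0 < P₁) (hP₂ : 0 < P₂) (hN : 0 < N)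
    (hR : R ∈ perfectFeedbackCapacity P₁ P₂ N) {ε : ℝ} (hε : 0 < ε) :
    ∃ ρ ∈ Set.Icc (0 : ℝ) 1,
      R.1 ≤ 1 / 2 * Real.log (1 + P₁ * (1 - ρ ^ 2) / N) + ε ∧
      R.2 ≤ 1 / 2 * Real.log (1 + P₂ * (1 - ρ ^ 2) / N) + ε ∧
      R.1 + R.2 ≤ 1 / 2 * Real.log (1 + (P₁ + P₂ + 2 * √(P₁ * P₂) * ρ) / N) + ε := by
  obtain ⟨hR₁, hR₂, hcode⟩ := hR
  set δ := min 1 (ε / (R.1 + R.2 + 3))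
  have hδ0 : 0 < δ := lt_min one_pos (by positivity)
  have hδε : δ * (R.1 + R.2 + 3) ≤ ε := (le_div_iff₀ (by positivity)).1 (min_le_right _ _)
  obtain ⟨n, ⟨c, hc₁, hc₂, hr₁, hr₂, he⟩, hnδ, hn⟩ := ((hcode δ hδ0 δ hδ0).and
    ((tendsto_one_div_atTop_nhds_zero_nat.eventually_le_const hδ0).and
      (eventually_gt_atTop 0))).exists
  obtain ⟨ρ, hρ, hb₁, hb₂, hb⟩ :=
    FeedbackCode.exists_one_sub_errorProb_mul_log_card_le hP₁ hP₂ hN hn hc₁ hc₂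
  have hL₁ : 0 ≤ Real.log c.M₁ := Real.log_natCast_nonneg _
  have hL₂ : 0 ≤ Real.log c.M₂ := Real.log_natCast_nonneg _
  have hbound {r L U : ℝ} (hrR : r ≤ R.1 + R.2) (hL : 0 ≤ L) (hr : r - 2 * δ ≤ 1 / n * L)
      (hU : (1 - c.errorProb N) * L ≤ n / 2 * U + 1) : r ≤ 1 / 2 * U + ε :=
    calc r ≤ 1 / 2 * U + δ * (r + 3) := le_half_add_of_one_sub_mul_le (by positivity) hnδ
          (min_le_left _ _) he hL hr hU
      _ ≤ 1 / 2 * U + δ * (R.1 + R.2 + 3) := by gcongr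
      _ ≤ 1 / 2 * U + ε := by gcongr
  exact ⟨ρ, hρ, hbound (by linarith) hL₁ (by linarith) hb₁,
    hbound (by linarith) hL₂ (by linarith) hb₂,
    hbound le_rfl (add_nonneg hL₁ hL₂) (by linarith) hb⟩

theorem exists_mem_ozarowRegion (hP₁ : 0 < P₁) (hP₂ : 0 < P₂) (hN : 0 < N)
    (hR : R ∈ perfectFeedbackCapacity P₁ P₂ N) :
    ∃ ρ ∈ Set.Icc (0 : ℝ) 1, R ∈ ozarowRegion P₁ P₂ N ρ := by
  have hcont {f : ℝ → ℝ} (hf : Continuous f) (hpos : ∀ ρ ∈ Set.Icc (0 : ℝ) 1, 0 ≤ f ρ) :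
      ContinuousOn (fun ρ => 1 / 2 * Real.log (1 + f ρ / N)) (Set.Icc 0 1) :=
    continuousOn_const.mul <| ContinuousOn.log (by fun_prop) fun ρ hρ =>
      (add_pos_of_pos_of_nonneg one_pos (div_nonneg (hpos ρ hρ) hN.le)).ne'
  have hsq (ρ : ℝ) (hρ : ρ ∈ Set.Icc (0 : ℝ) 1) : 0 ≤ 1 - ρ ^ 2 :=
    sub_nonneg.2 (pow_le_one₀ hρ.1 hρ.2)
  obtain ⟨ρ, hρ, h⟩ := exists_mem_forall_le_of_forall_pos isCompact_Icc
    (f := ![fun ρ => 1 / 2 * Real.log (1 + P₁ * (1 - ρ ^ 2) / N),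
      fun ρ => 1 / 2 * Real.log (1 + P₂ * (1 - ρ ^ 2) / N),
      fun ρ => 1 / 2 * Real.log (1 + (P₁ + P₂ + 2 * √(P₁ * P₂) * ρ) / N)])
    (r := ![R.1, R.2, R.1 + R.2]) (by
      simp only [Fin.forall_fin_succ, IsEmpty.forall_iff, and_true]
      exact ⟨hcont (by fun_prop) fun ρ hρ => mul_nonneg hP₁.le (hsq ρ hρ),
        hcont (by fun_prop) fun ρ hρ => mul_nonneg hP₂.le (hsq ρ hρ),
        hcont (by fun_prop) fun ρ hρ => by have := hρ.1; positivity⟩) (fun ε hε => by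
      simp only [Fin.forall_fin_succ, IsEmpty.forall_iff, and_true]
      exact exists_forall_le_ozarow_add hP₁ hP₂ hN hR hε)
  exact ⟨ρ, hρ, hR.1, hR.2.1, h 0, h 1, h 2⟩

theorem sumRate_lt_of_ne_ozarowCorner (hP₁ : 0 < P₁) (hP₂ : 0 < P₂) (hN : 0 < N)
    (hR : R ∈ perfectFeedbackCapacity P₁ P₂ N) (hne : R ≠ ozarowCorner P₁ P₂ N) :
    R.1 + R.2 < (ozarowCorner P₁ P₂ N).1 + (ozarowCorner P₁ P₂ N).2 := by
  obtain ⟨ρ, hρ, -, -, h₁, h₂, hsum⟩ := exists_mem_ozarowRegion hP₁ hP₂ hN hR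
  have hρ0 := hρ.1
  have hstar := rhoStar_mem_Ioo hP₁ hP₂ hN
  rcases lt_trichotomy ρ (rhoStar P₁ P₂ N) with h | rfl | h
  · rw [ozarowCorner_fst_add_snd hP₁ hP₂ hN]
    refine hsum.trans_lt ?_
    have : 0 < √(P₁ * P₂) := Real.sqrt_pos.2 (mul_pos hP₁ hP₂)
    gcongr
  · contrapose! hne
    refine Prod.ext (h₁.antisymm ?_) (h₂.antisymm ?_) <;>
    simp only [ozarowCorner_fst, ozarowCorner_snd, gain] at hne ⊢ <;> linarith
  · have hlt {p : ℝ} (hp : 0 < p) : 1 / 2 * Real.log (1 + p * (1 - ρ ^ 2) / N) <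
        1 / 2 * Real.log (gain N (rhoStar P₁ P₂ N) p) := by
      have : 0 ≤ 1 - ρ ^ 2 := sub_nonneg.2 (pow_le_one₀ hρ.1 hρ.2)
      have := hstar.1
      rw [gain]
      gcongr
    exact add_lt_add (h₁.trans_lt (hlt hP₁)) (h₂.trans_lt (hlt hP₂))

end Converse

/-! ### Linear functionals of the noise -/

section LinearNoise

variable {n : ℕ}

theorem memLp_affine_noise (N b : ℝ) (f : Fin n → ℝ) (S : Finset (Fin n)) :
    MemLp (fun z : Fin n → ℝ => b + ∑ s ∈ S, f s * z s) 2 (noiseLaw n N) :=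
  (memLp_const b).add (memLp_finsetSum _ fun s _ => (memLp_noise N s).const_mul (f s))

theorem integral_affine_noise_sq {N : ℝ} (hN : 0 < N) (b : ℝ) (f : Fin n → ℝ)
    (S : Finset (Fin n)) :
    ∫ z, (b + ∑ s ∈ S, f s * z s) ^ 2 ∂noiseLaw n N = b ^ 2 + N * ∑ s ∈ S, f s ^ 2 := by
  induction S using Finset.induction_on with
  | empty => simp
  | insert t S ht ih =>
    have hcross : ∫ z, (b + ∑ s ∈ S, f s * z s) * z t ∂noiseLaw n N = 0 :=
      integral_mul_noise_eq_zero N t (by fun_prop) fun z => by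
        congr 1
        refine sum_congr rfl fun s hs => ?_
        rw [Function.update_of_ne (ne_of_mem_of_not_mem hs ht)]
    have hsplit (z : Fin n → ℝ) : b + ∑ s ∈ insert t S, f s * z s =
        1 * (b + ∑ s ∈ S, f s * z s) + f t * z t := by
      rw [sum_insert ht]
      ring
    simp only [hsplit]
    rw [integral_sq_linearCombination (memLp_affine_noise N b f S) (memLp_noise N t), ih, hcross,
      integral_noise_sq hN, sum_insert ht]
    ring

theorem prob_le_abs_linear_noise {N : ℝ} (hN : 0 < N) (f : Fin n → ℝ) {r : ℝ} (hr : 0 < r) :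
    (noiseLaw n N).real {z | r ≤ |∑ s, f s * z s|} ≤ N * ∑ s, f s ^ 2 / r ^ 2 := by
  have hset : {z : Fin n → ℝ | r ≤ |∑ s, f s * z s|} =
      {z | r ^ 2 ≤ (0 + ∑ s, f s * z s) ^ 2} := by
    ext z
    rw [Set.mem_ofPred_eq, Set.mem_ofPred_eq, zero_add, sq_le_sq, abs_of_pos hr]
  have hmarkov := mul_meas_ge_le_integral_of_nonneg (μ := noiseLaw n N)
    (f := fun z => (0 + ∑ s, f s * z s) ^ 2) (Eventually.of_forall fun z => sq_nonneg _)
    (memLp_affine_noise N 0 f univ).integrable_sq (r ^ 2)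
  rw [integral_affine_noise_sq hN, zero_pow two_ne_zero, zero_add, ← hset] at hmarkov
  rw [← sum_div, ← mul_div_assoc, le_div_iff₀ (by positivity), mul_comm]
  exact hmarkov

end LinearNoise

/-! ### Pulse-amplitude modulation -/

section Pam

variable {M : ℕ}

/-- The `i`-th of `M` equidistant points of `[-1, 1]`, the midpoints of `M` intervals of equal
length: the real number that represents the message `i`. -/
def pam (M : ℕ) (i : Fin M) : ℝ := (2 * (i : ℕ) + 1) / M - 1

/-- The message whose point is nearest to the estimate `x`. -/
def pamDecode (hM : 0 < M) (x : ℝ) : Fin M :=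
  ⟨min ⌊(M : ℝ) * (x + 1) / 2⌋.toNat (M - 1), by omega⟩

theorem pam_sq_le_one (i : Fin M) : pam M i ^ 2 ≤ 1 := by
  have hM : (0 : ℝ) < M := by exact_mod_cast i.pos
  have hi : ((i : ℕ) : ℝ) + 1 ≤ M := by exact_mod_cast i.isLt
  have hpos : (0 : ℝ) ≤ (2 * (i : ℕ) + 1) / M := by positivity
  have hle : (2 * ((i : ℕ) : ℝ) + 1) / M ≤ 2 := by
    rw [div_le_iff₀ hM]
    linarith
  rw [sq_le_one_iff_abs_le_one, abs_le, pam]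
  constructor <;> linarith

theorem sum_pam_sq_le (M : ℕ) : ∑ i, pam M i ^ 2 ≤ M := by
  simpa using sum_le_sum fun i (_ : i ∈ univ) => pam_sq_le_one (M := M) i

theorem pam_rev (i : Fin M) : pam M i.rev = -pam M i := by
  have hM : (M : ℝ) ≠ 0 := by exact_mod_cast i.pos.ne'
  rw [pam, pam, Fin.val_rev, Nat.cast_sub i.isLt]
  push_cast
  field_simp
  ring

theorem sum_pam (M : ℕ) : ∑ i, pam M i = 0 := by
  have h : ∑ i, pam M i = -∑ i, pam M i := by
    rw [← sum_neg_distrib, ← Equiv.sum_comp Fin.revPerm]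
    exact sum_congr rfl fun i _ => pam_rev i
  linarith

theorem measurable_pamDecode (hM : 0 < M) : Measurable (pamDecode hM) := by
  have h : Measurable fun k : ℤ => (⟨min k.toNat (M - 1), by omega⟩ : Fin M) :=
    measurable_from_top
  exact h.comp (Int.measurable_floor.comp (by fun_prop))

theorem pamDecode_pam_add (hM : 0 < M) (i : Fin M) {e : ℝ} (he : |e| < 1 / M) :
    pamDecode hM (pam M i + e) = i := by
  have hM' : (0 : ℝ) < M := by exact_mod_cast hM
  have hx : (M : ℝ) * (pam M i + e + 1) / 2 = (i : ℕ) + 1 / 2 + e * M / 2 := by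
    rw [pam]
    field_simp
    ring
  have hfloor : ⌊(M : ℝ) * (pam M i + e + 1) / 2⌋ = (i : ℕ) := by
    rw [lt_div_iff₀ hM', ← abs_of_pos hM', ← abs_mul, abs_lt] at he
    rw [hx, Int.floor_eq_iff]
    push_cast
    constructor <;> linarith [he.1, he.2]
  apply Fin.ext
  simp only [pamDecode, hfloor, Int.toNat_natCast]
  omega

/-- The points that represent a pair of messages. -/
def pamPair (M : Fin 2 → ℕ) (i : Fin (M 0)) (j : Fin (M 1)) : Fin 2 → ℝ :=
  ![pam (M 0) i, pam (M 1) j]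

theorem average_pamPair_sq_le {M : Fin 2 → ℕ} (hM : ∀ ν, 0 < M ν) (g : Fin 2 → ℝ) (V : ℝ) :
    1 / ((M 0 : ℝ) * M 1) * ∑ i, ∑ j, ((∑ μ, g μ * pamPair M i j μ) ^ 2 + V) ≤
      ∑ μ, g μ ^ 2 + V := by
  have hexpand (i : Fin (M 0)) (j : Fin (M 1)) : (∑ μ, g μ * pamPair M i j μ) ^ 2 + V =
      g 0 ^ 2 * pam (M 0) i ^ 2 + 2 * g 0 * g 1 * (pam (M 0) i * pam (M 1) j) +
        g 1 ^ 2 * pam (M 1) j ^ 2 + V := by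
    simp only [Fin.sum_univ_two, pamPair, cons_val_zero, cons_val_one]
    ring
  have hsum : ∑ i, ∑ j, ((∑ μ, g μ * pamPair M i j μ) ^ 2 + V) =
      g 0 ^ 2 * (M 1 * ∑ i, pam (M 0) i ^ 2) + g 1 ^ 2 * (M 0 * ∑ j, pam (M 1) j ^ 2) +
        M 0 * M 1 * V := by
    simp only [hexpand, sum_add_distrib, ← mul_sum, sum_pam, mul_zero, sum_const_zero, sum_const,
      card_univ, Fintype.card_fin, nsmul_eq_mul]
    ring
  have h₀ := hM 0
  have h₁ := hM 1
  rw [one_div, inv_mul_le_iff₀ (by positivity), hsum, Fin.sum_univ_two]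
  calc g 0 ^ 2 * (M 1 * ∑ i, pam (M 0) i ^ 2) + g 1 ^ 2 * (M 0 * ∑ j, pam (M 1) j ^ 2) +
        M 0 * M 1 * V
      ≤ g 0 ^ 2 * (M 1 * M 0) + g 1 ^ 2 * (M 0 * M 1) + M 0 * M 1 * V := by
        gcongr <;> exact sum_pam_sq_le _
    _ = M 0 * M 1 * (g 0 ^ 2 + g 1 ^ 2 + V) := by ring

end Pam

/-! ### Linear feedback codes -/

section LinearCode

variable {n : ℕ}

/-- The feedback code in which transmitter `ν` sends `a_ν θ_ν + B_ν Y`, where `θ_ν` represents its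
message and `B = feedbackMatrix F`. The receiver undoes the feedback, `(1 + ∑ F)⁻¹ Y = A θ + Z`,
and decodes the linear estimate `W (A θ + Z)` of `θ`. -/
def linearCode (a : Fin 2 → Fin n → ℝ) (F : Fin 2 → Matrix (Fin n) (Fin n) ℝ)
    (W : Matrix (Fin 2) (Fin n) ℝ) (M : Fin 2 → ℕ) (hM : ∀ ν, 0 < M ν) : FeedbackCode n where
  M₁ := M 0
  M₂ := M 1
  enc₁ t i p :=
    a 0 t * pam (M 0) i + ∑ s : Fin t, feedbackMatrix F 0 t (Fin.castLE t.isLt.le s) * p s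
  enc₂ t j p :=
    a 1 t * pam (M 1) j + ∑ s : Fin t, feedbackMatrix F 1 t (Fin.castLE t.isLt.le s) * p s
  dec y := (pamDecode (hM 0) ((W *ᵥ ((1 + ∑ μ, F μ)⁻¹ *ᵥ y)) 0),
    pamDecode (hM 1) ((W *ᵥ ((1 + ∑ μ, F μ)⁻¹ *ᵥ y)) 1))
  measurable_enc₁ t i := by fun_prop
  measurable_enc₂ t j := by fun_prop
  measurable_dec := by
    have hest (ν : Fin 2) :
        Measurable fun y : Fin n → ℝ => (W *ᵥ ((1 + ∑ μ, F μ)⁻¹ *ᵥ y)) ν := by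
      simp only [mulVec, dotProduct]
      fun_prop
    exact ((measurable_pamDecode (hM 0)).comp (hest 0)).prodMk
      ((measurable_pamDecode (hM 1)).comp (hest 1))

theorem sum_castLE_mul_past {B : Matrix (Fin n) (Fin n) ℝ} (hB : IsStrictlyLower B)
    (y : Fin n → ℝ) (t : Fin n) :
    ∑ s : Fin t, B t (Fin.castLE t.isLt.le s) * past y t s = (B *ᵥ y) t := by
  have hsub := Finset.sum_subset (f := fun s => B t s * y s)
    (subset_univ (univ.map (Fin.castLEEmb t.isLt.le))) fun s _ hs => by
      have hts : t ≤ s := not_lt.1 fun hst => hs (mem_map.2 ⟨⟨s, hst⟩, mem_univ _, rfl⟩)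
      rw [hB t s hts, zero_mul]
  rw [sum_map] at hsub
  exact hsub

variable {a : Fin 2 → Fin n → ℝ} {F : Fin 2 → Matrix (Fin n) (Fin n) ℝ}
  {W : Matrix (Fin 2) (Fin n) ℝ} {M : Fin 2 → ℕ} {hM : ∀ ν, 0 < M ν}

theorem sum_feedbackMatrix_mul_past (hF : ∀ ν, IsStrictlyLower (F ν)) (v : Fin n → ℝ) (ν : Fin 2)
    (t : Fin n) :
    ∑ s : Fin t, feedbackMatrix F ν t (Fin.castLE t.isLt.le s) *
      past ((1 + ∑ μ, F μ) *ᵥ v) t s = (F ν *ᵥ v) t := by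
  rw [sum_castLE_mul_past (isStrictlyLower_feedbackMatrix hF ν), mulVec_mulVec,
    feedbackMatrix_mul_one_add_sum hF]

theorem linearCode_received (hF : ∀ ν, IsStrictlyLower (F ν)) (i : Fin (M 0)) (j : Fin (M 1))
    (z : Fin n → ℝ) : (linearCode a F W M hM).received i j z =
      (1 + ∑ μ, F μ) *ᵥ (aRow a *ᵥ pamPair M i j + z) := by
  refine FeedbackCode.received_eq_of_forall _ _ _ fun t => ?_
  have hA : (aRow a *ᵥ pamPair M i j) t = a 0 t * pam (M 0) i + a 1 t * pam (M 1) j := by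
    simp [mulVec, dotProduct, aRow, pamPair]
  simp only [FeedbackCode.totalInput, linearCode, sum_feedbackMatrix_mul_past hF]
  rw [add_mulVec, one_mulVec, sum_mulVec, Fin.sum_univ_two]
  simp only [Pi.add_apply, hA]
  ring

theorem linearCode_output (hF : ∀ ν, IsStrictlyLower (F ν)) (i : Fin (M 0)) (j : Fin (M 1))
    (z : Fin n → ℝ) (t : Fin n) : (linearCode a F W M hM).output i j z t t.isLt.le =
      past ((1 + ∑ μ, F μ) *ᵥ (aRow a *ᵥ pamPair M i j + z)) t :=
  ((linearCode a F W M hM).past_received i j z t).symm.trans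
    (congrArg (fun y => past y t) (linearCode_received hF i j z))

theorem linearCode_input₁ (hF : ∀ ν, IsStrictlyLower (F ν)) (i : Fin (M 0)) (j : Fin (M 1))
    (z : Fin n → ℝ) (t : Fin n) : (linearCode a F W M hM).input₁ i j z t =
      a 0 t * pamPair M i j 0 + (F 0 *ᵥ (aRow a *ᵥ pamPair M i j + z)) t := by
  rw [← sum_feedbackMatrix_mul_past hF, ← linearCode_output (W := W) (hM := hM) hF]
  rfl

theorem linearCode_input₂ (hF : ∀ ν, IsStrictlyLower (F ν)) (i : Fin (M 0)) (j : Fin (M 1))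
    (z : Fin n → ℝ) (t : Fin n) : (linearCode a F W M hM).input₂ i j z t =
      a 1 t * pamPair M i j 1 + (F 1 *ᵥ (aRow a *ᵥ pamPair M i j + z)) t := by
  rw [← sum_feedbackMatrix_mul_past hF, ← linearCode_output (W := W) (hM := hM) hF]
  rfl

theorem linearInput_eq (a : Fin 2 → Fin n → ℝ) (F : Fin 2 → Matrix (Fin n) (Fin n) ℝ)
    (θ : Fin 2 → ℝ) (z : Fin n → ℝ) (ν : Fin 2) (t : Fin n) :
    a ν t * θ ν + (F ν *ᵥ (aRow a *ᵥ θ + z)) t =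
      ∑ μ, ((if ν = μ then a μ t else 0) + (F ν *ᵥ a μ) t) * θ μ + ∑ s, F ν t s * z s := by
  have hA : aRow a *ᵥ θ = ∑ μ, θ μ • a μ := by
    ext s
    simp [mulVec, dotProduct, aRow, mul_comm]
  simp only [add_mul, sum_add_distrib, ite_mul, zero_mul, sum_ite_eq, mem_univ, if_true]
  rw [hA, mulVec_add, mulVec_sum, Pi.add_apply, Finset.sum_apply, ← add_assoc]
  simp only [mulVec_smul, Pi.smul_apply, smul_eq_mul, mul_comm]
  rfl

theorem linearCode_powerConstraint {N P : ℝ} (hN : 0 < N) (hn : 0 < n) (ν : Fin 2)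
    (hP : linearPower N a F ν ≤ n * P) {X : Fin (M 0) → Fin (M 1) → (Fin n → ℝ) → Fin n → ℝ}
    (hX : ∀ i j z t, X i j z t =
      a ν t * pamPair M i j ν + (F ν *ᵥ (aRow a *ᵥ pamPair M i j + z)) t) :
    (linearCode a F W M hM).PowerConstraint N P X := by
  simp only [linearInput_eq] at hX
  have hmoment (i : Fin (M 0)) (j : Fin (M 1)) (t : Fin n) : ∫ z, X i j z t ^ 2 ∂noiseLaw n N =
      (∑ μ, ((if ν = μ then a μ t else 0) + (F ν *ᵥ a μ) t) * pamPair M i j μ) ^ 2 +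
        N * ∑ s, F ν t s ^ 2 := by
    simp only [hX, integral_affine_noise_sq hN]
  refine ⟨fun i j t => ?_, ?_⟩
  · exact (memLp_affine_noise N _ _ univ).integrable_sq.congr
      (Eventually.of_forall fun z => congrArg (· ^ 2) (hX i j z t).symm)
  · have hn' : (0 : ℝ) < n := by exact_mod_cast hn
    rw [one_div, inv_mul_le_iff₀ hn']
    refine le_trans (sum_le_sum fun t _ => ?_) hP
    exact (congrArg (1 / ((M 0 : ℝ) * M 1) * ·) (sum_congr rfl fun i _ => sum_congr rfl fun j _ =>
      hmoment i j t)).trans_le (average_pamPair_sq_le hM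
        (fun μ => (if ν = μ then a μ t else 0) + (F ν *ᵥ a μ) t) (N * ∑ s, F ν t s ^ 2))

theorem linearCode_dec_output (hF : ∀ ν, IsStrictlyLower (F ν)) (hW : W * aRow a = 1)
    (i : Fin (M 0)) (j : Fin (M 1)) (z : Fin n → ℝ) :
    (linearCode a F W M hM).dec ((linearCode a F W M hM).output i j z n le_rfl) =
      (pamDecode (hM 0) (pam (M 0) i + ∑ s, W 0 s * z s),
        pamDecode (hM 1) (pam (M 1) j + ∑ s, W 1 s * z s)) := by
  have hest : W *ᵥ ((1 + ∑ μ, F μ)⁻¹ *ᵥ (linearCode a F W M hM).received i j z) =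
      pamPair M i j + W *ᵥ z := by
    rw [linearCode_received hF, mulVec_mulVec _ (_⁻¹),
      nonsing_inv_mul _ (IsStrictlyLower.sum hF).isUnit_det_one_add, one_mulVec, mulVec_add,
      mulVec_mulVec, hW, one_mulVec]
  exact congrArg (fun x : Fin 2 → ℝ => (pamDecode (hM 0) (x 0), pamDecode (hM 1) (x 1))) hest

theorem prob_linearCode_dec_ne_le {N : ℝ} (hN : 0 < N) (hF : ∀ ν, IsStrictlyLower (F ν))
    (hW : W * aRow a = 1) (i : Fin (M 0)) (j : Fin (M 1)) :
    (noiseLaw n N).real {z | (linearCode a F W M hM).dec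
      ((linearCode a F W M hM).output i j z n le_rfl) ≠ (i, j)} ≤
      ∑ ν, (M ν : ℝ) ^ 2 * (N * (W * Wᵀ) ν ν) := by
  have hsub : {z | (linearCode a F W M hM).dec
      ((linearCode a F W M hM).output i j z n le_rfl) ≠ (i, j)} ⊆
      {z | 1 / (M 0 : ℝ) ≤ |∑ s, W 0 s * z s|} ∪ {z | 1 / (M 1 : ℝ) ≤ |∑ s, W 1 s * z s|} := by
    intro z hz
    by_contra hcon
    simp only [Set.mem_union, Set.mem_ofPred_eq, not_or, not_le] at hcon
    refine hz ?_
    rw [linearCode_dec_output hF hW, pamDecode_pam_add _ i hcon.1, pamDecode_pam_add _ j hcon.2]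
  have hle (ν : Fin 2) : (noiseLaw n N).real {z | 1 / (M ν : ℝ) ≤ |∑ s, W ν s * z s|} ≤
      (M ν : ℝ) ^ 2 * (N * (W * Wᵀ) ν ν) := by
    have := hM ν
    refine (prob_le_abs_linear_noise hN (W ν) (by positivity)).trans_eq ?_
    simp only [Matrix.mul_apply, transpose_apply, ← sq, ← sum_div]
    field_simp
  rw [Fin.sum_univ_two]
  exact (measureReal_mono hsub).trans
    ((measureReal_union_le _ _).trans (add_le_add (hle 0) (hle 1)))

theorem linearCode_errorProb_le {N : ℝ} (hN : 0 < N) (hF : ∀ ν, IsStrictlyLower (F ν))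
    (hW : W * aRow a = 1) :
    (linearCode a F W M hM).errorProb N ≤ ∑ ν, (M ν : ℝ) ^ 2 * (N * (W * Wᵀ) ν ν) := by
  have h₀ := hM 0
  have h₁ := hM 1
  have hsum := sum_le_sum fun i (_ : i ∈ univ) => sum_le_sum fun j (_ : j ∈ univ) =>
    prob_linearCode_dec_ne_le (hM := hM) hN hF hW i j
  simp only [sum_const, card_univ, Fintype.card_fin, nsmul_eq_mul] at hsum
  change 1 / ((M 0 : ℝ) * M 1) * _ ≤ _
  rw [one_div, inv_mul_le_iff₀ (by positivity), mul_assoc]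
  exact hsum

end LinearCode

/-! ### Achievability of the corner point -/

section ZeroForcing

variable {m ι : Type*} [Fintype m] [Fintype ι] [DecidableEq ι] {A : Matrix m ι ℝ}

/-- The pseudoinverse `(AᵀA)⁻¹Aᵀ`, which estimates `x` from `A x + z` without bias. -/
def zeroForcing (A : Matrix m ι ℝ) : Matrix ι m ℝ := (Aᵀ * A)⁻¹ * Aᵀ

theorem zeroForcing_mul_self (hA : (Aᵀ * A).det ≠ 0) : zeroForcing A * A = 1 := by
  rw [zeroForcing, Matrix.mul_assoc, nonsing_inv_mul _ hA.isUnit]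

theorem zeroForcing_mul_transpose (hA : (Aᵀ * A).det ≠ 0) :
    zeroForcing A * (zeroForcing A)ᵀ = (Aᵀ * A)⁻¹ := by
  rw [zeroForcing, transpose_mul, transpose_transpose, transpose_nonsing_inv, transpose_mul,
    transpose_transpose, Matrix.mul_assoc, ← Matrix.mul_assoc Aᵀ,
    mul_nonsing_inv _ hA.isUnit, Matrix.mul_one]

end ZeroForcing

section Achievability

variable {N ρ : ℝ} {P : Fin 2 → ℝ} {m : ℕ}

theorem inv_gram_ozarowBlock_diag_le (hN : 0 < N) (hρ : ρ ∈ Set.Ioo (0 : ℝ) 1)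
    (hP : ∀ ν, 0 < P ν) (h : RhoEquation (P 0) (P 1) N ρ)
    (hm : ∀ ν, 4 / (1 - ρ ^ 2) ≤ precision N ρ (P ν) m) (k : ℕ) (ν : Fin 2) :
    N * ((aRow (initialBlock (m + 1 + k) (ozarowBlock N ρ P m)))ᵀ *
      aRow (initialBlock (m + 1 + k) (ozarowBlock N ρ P m)))⁻¹ ν ν ≤
      2 / ((1 - ρ ^ 2) * precision N ρ (P ν) m) := by
  have hdet := det_gram_ozarowBlock_ge hN hρ hP h hm k
  have hpos := det_gram_ozarowBlock_pos hN hρ hP h hm k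
  have hτ := one_sub_sq_pos hρ
  have hJ (μ : Fin 2) := precision_pos hN hρ (hP μ) m
  have hgram (μ : Fin 2) : ((aRow (initialBlock (m + 1 + k) (ozarowBlock N ρ P m)))ᵀ *
      aRow (initialBlock (m + 1 + k) (ozarowBlock N ρ P m))) μ μ ≤ N * precision N ρ (P μ) m := by
    rw [transpose_aRow_mul_aRow hN.ne', information_ozarowBlock, min_eq_right (by omega),
      Matrix.smul_apply, Matrix.sub_apply, information_ozarowAmplitude_diag hN hρ hP, one_apply_eq,
      smul_eq_mul]
    linarith
  have hbound {D G J J' : ℝ} (hD : 0 < D) (hJ : 0 < J) (hG : G ≤ N * J')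
      (hDJ : N ^ 2 * ((1 - ρ ^ 2) / 2 * (J * J')) ≤ D) :
      N * (D⁻¹ * G) ≤ 2 / ((1 - ρ ^ 2) * J) := by
    rw [inv_mul_eq_div, mul_div_assoc', div_le_div_iff₀ hD (by positivity)]
    nlinarith [mul_le_mul_of_nonneg_left hG (by positivity : 0 ≤ N * ((1 - ρ ^ 2) * J))]
  rw [Matrix.inv_def, Ring.inverse_eq_inv', Matrix.smul_apply, smul_eq_mul, adjugate_fin_two]
  fin_cases ν
  · exact hbound hpos (hJ 0) (hgram 1) hdet
  · exact hbound hpos (hJ 1) (hgram 0) (mul_comm (precision N ρ (P 0) m) _ ▸ hdet)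

theorem exists_forall_exists_code (hN : 0 < N) (hρ : ρ ∈ Set.Ioo (0 : ℝ) 1) (hP : ∀ ν, 0 < P ν)
    (h : RhoEquation (P 0) (P 1) N ρ) :
    ∃ k : ℕ, ∀ m : ℕ, (∀ ν, 4 / (1 - ρ ^ 2) ≤ precision N ρ (P ν) m) →
      ∀ M : Fin 2 → ℕ, (∀ ν, 0 < M ν) → ∃ c : FeedbackCode (m + 1 + k),
        c.PowerConstraint N (P 0) c.input₁ ∧ c.PowerConstraint N (P 1) c.input₂ ∧
        c.M₁ = M 0 ∧ c.M₂ = M 1 ∧ c.errorProb N ≤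
          ∑ ν, (M ν : ℝ) ^ 2 * (2 / ((1 - ρ ^ 2) * precision N ρ (P ν) m)) := by
  obtain ⟨k, hpow⟩ := exists_forall_linearPower_ozarowBlock_lt hN hρ hP h
  refine ⟨k, fun m hm M hM => ?_⟩
  have hG := (det_gram_ozarowBlock_pos hN hρ hP h hm k).ne'
  have hF := isStrictlyLower_mmseFeedback N (ozarowBlock N ρ P m) (m + 1 + k)
  refine ⟨linearCode (initialBlock (m + 1 + k) (ozarowBlock N ρ P m))
    (mmseFeedback N (ozarowBlock N ρ P m) (m + 1 + k)) (zeroForcing (aRow _)) M hM,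
    linearCode_powerConstraint hN (by omega) 0 (hpow m 0).le (linearCode_input₁ hF),
    linearCode_powerConstraint hN (by omega) 1 (hpow m 1).le (linearCode_input₂ hF), rfl, rfl,
    (linearCode_errorProb_le hN hF (zeroForcing_mul_self hG)).trans ?_⟩
  rw [zeroForcing_mul_transpose hG]
  gcongr with ν
  exact inv_gram_ozarowBlock_diag_le hN hρ hP h hm k ν

theorem tendsto_exp_sq_div_precision {p r : ℝ} (hN : 0 < N) (hρ : ρ ∈ Set.Ioo (0 : ℝ) 1)
    (hp : 0 < p) (hr : r < 1 / 2 * Real.log (gain N ρ p)) (k : ℕ) :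
    Tendsto (fun m : ℕ => Real.exp (((m + 1 + k : ℕ) : ℝ) * r) ^ 2 / precision N ρ p m)
      atTop (𝓝 0) := by
  have hg := gain_pos hN hρ hp
  have hratio : Real.exp (2 * r) / gain N ρ p < 1 := by
    rw [div_lt_one hg, ← Real.lt_log_iff_exp_lt hg]
    linarith
  have hlim := (tendsto_pow_atTop_nhds_zero_of_lt_one (by positivity) hratio).const_mul
    (Real.exp (2 * (1 + k) * r) * (1 - ρ))
  rw [mul_zero] at hlim
  refine hlim.congr fun m => ?_
  have hexp : Real.exp (((m + 1 + k : ℕ) : ℝ) * r) ^ 2 =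
      Real.exp (2 * (1 + k) * r) * Real.exp (2 * r) ^ m := by
    rw [← Real.exp_nat_mul, ← Real.exp_nat_mul, ← Real.exp_add]
    push_cast
    ring_nf
  rw [hexp, precision, div_pow]
  field_simp

theorem exists_card_of_rate {n : ℕ} (hn : 0 < n) {r : ℝ} (hr : 0 ≤ r) :
    ∃ M : ℕ, 0 < M ∧ r ≤ 1 / (n : ℝ) * Real.log M ∧ (M : ℝ) ≤ 2 * Real.exp (n * r) := by
  have hn' : (0 : ℝ) < n := by exact_mod_cast hn
  have hM : 0 < ⌈Real.exp (n * r)⌉₊ := Nat.ceil_pos.2 (Real.exp_pos _)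
  refine ⟨⌈Real.exp (n * r)⌉₊, hM, ?_, ?_⟩
  · rw [one_div, le_inv_mul_iff₀ hn', Real.le_log_iff_exp_le (by exact_mod_cast hM)]
    exact Nat.le_ceil _
  · have hceil := Nat.ceil_lt_add_one (Real.exp_pos (n * r)).le
    have hone : 1 ≤ Real.exp (n * r) := Real.one_le_exp (mul_nonneg hn'.le hr)
    linarith

theorem eventually_exists_code (hN : 0 < N) (hρ : ρ ∈ Set.Ioo (0 : ℝ) 1) (hP : ∀ ν, 0 < P ν)
    (h : RhoEquation (P 0) (P 1) N ρ) {r : Fin 2 → ℝ} (hr : ∀ ν, 0 ≤ r ν)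
    (hlt : ∀ ν, r ν < 1 / 2 * Real.log (gain N ρ (P ν))) {ε : ℝ} (hε : 0 < ε) :
    ∀ᶠ n : ℕ in atTop, ∃ c : FeedbackCode n,
      c.PowerConstraint N (P 0) c.input₁ ∧ c.PowerConstraint N (P 1) c.input₂ ∧
      r 0 ≤ 1 / (n : ℝ) * Real.log c.M₁ ∧ r 1 ≤ 1 / (n : ℝ) * Real.log c.M₂ ∧
      c.errorProb N ≤ ε := by
  obtain ⟨k, hk⟩ := exists_forall_exists_code hN hρ hP h
  have hτ := one_sub_sq_pos hρ
  have hlarge : ∀ᶠ m in atTop, ∀ ν, 4 / (1 - ρ ^ 2) ≤ precision N ρ (P ν) m :=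
    eventually_all.2 fun ν => (tendsto_precision_atTop hN hρ (hP ν)).eventually_ge_atTop _
  have herror : ∀ᶠ m : ℕ in atTop, ∑ ν, 8 / (1 - ρ ^ 2) *
      (Real.exp (((m + 1 + k : ℕ) : ℝ) * r ν) ^ 2 / precision N ρ (P ν) m) ≤ ε := by
    have hlim := tendsto_finsetSum univ fun ν (_ : ν ∈ univ) =>
      (tendsto_exp_sq_div_precision hN hρ (hP ν) (hlt ν) k).const_mul (8 / (1 - ρ ^ 2))
    simp only [mul_zero, sum_const_zero] at hlim
    exact hlim.eventually_le_const hε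
  rw [← map_add_atTop_eq_nat (1 + k), eventually_map]
  filter_upwards [hlarge, herror] with m hm he
  rw [← add_assoc]
  choose M hM hrate hcard using fun ν => exists_card_of_rate (n := m + 1 + k) (by omega) (hr ν)
  obtain ⟨c, hc₁, hc₂, hM₁, hM₂, hc⟩ := hk m hm M hM
  refine ⟨c, hc₁, hc₂, hM₁ ▸ hrate 0, hM₂ ▸ hrate 1, hc.trans (le_trans ?_ he)⟩
  refine sum_le_sum fun ν _ => ?_
  have hJ := precision_pos hN hρ (hP ν) m
  calc (M ν : ℝ) ^ 2 * (2 / ((1 - ρ ^ 2) * precision N ρ (P ν) m))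
      ≤ (2 * Real.exp (((m + 1 + k : ℕ) : ℝ) * r ν)) ^ 2 *
        (2 / ((1 - ρ ^ 2) * precision N ρ (P ν) m)) := by gcongr; exact hcard ν
    _ = 8 / (1 - ρ ^ 2) *
        (Real.exp (((m + 1 + k : ℕ) : ℝ) * r ν) ^ 2 / precision N ρ (P ν) m) := by
      field_simp
      ring

end Achievability

theorem ozarowCorner_mem_capacity {P₁ P₂ N : ℝ} (hP₁ : 0 < P₁) (hP₂ : 0 < P₂) (hN : 0 < N) :
    ozarowCorner P₁ P₂ N ∈ perfectFeedbackCapacity P₁ P₂ N := by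
  obtain ⟨hc₁, hc₂, -⟩ := ozarowCorner_mem_ozarowRegion hP₁ hP₂ hN
  refine ⟨hc₁, hc₂, fun δ hδ ε hε => ?_⟩
  have hρ := rhoStar_mem_Ioo hP₁ hP₂ hN
  have hP : ∀ ν, 0 < ![P₁, P₂] ν := Fin.forall_fin_two.2 ⟨hP₁, hP₂⟩
  have hcodes := eventually_exists_code (P := ![P₁, P₂]) hN hρ hP (rhoStar_spec hP₁ hP₂ hN).2
    (r := fun ν => max 0 (1 / 2 * Real.log (gain N (rhoStar P₁ P₂ N) (![P₁, P₂] ν)) - δ / 2))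
    (fun ν => le_max_left _ _)
    (fun ν => max_lt (half_log_gain_pos hN hρ (hP ν)) (by linarith)) hε
  filter_upwards [hcodes] with n ⟨c, hp₁, hp₂, hr₁, hr₂, herr⟩
  have hlt {x y : ℝ} (hxy : max 0 (x - δ / 2) ≤ y) : x - δ < y :=
    lt_of_lt_of_le (by linarith) ((le_max_right _ _).trans hxy)
  exact ⟨c, hp₁, hp₂, hlt hr₁, hlt hr₂, herr⟩

end AWGNMAC

end

theorem mainTheorem7 (P₁ P₂ N : ℝ) (hP₁ : 0 < P₁) (hP₂ : 0 < P₂) (hN : 0 < N) :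
    AWGNMAC.ozarowRegion P₁ P₂ N (AWGNMAC.rhoStar P₁ P₂ N) ⊆
      closure (AWGNMAC.vanishingNoiseRegion P₁ P₂ N) ∧
    (AWGNMAC.ozarowCorner P₁ P₂ N ∈ AWGNMAC.perfectFeedbackCapacity P₁ P₂ N ∧
      ∀ R ∈ AWGNMAC.perfectFeedbackCapacity P₁ P₂ N, R ≠ AWGNMAC.ozarowCorner P₁ P₂ N →
        R.1 + R.2 < (AWGNMAC.ozarowCorner P₁ P₂ N).1 + (AWGNMAC.ozarowCorner P₁ P₂ N).2) ∧
    (∀ ε > (0 : ℝ), ∃ σ > (0 : ℝ), ∀ K : Matrix (Fin 2) (Fin 2) ℝ,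
      K.PosSemidef → K.trace ≤ σ ^ 2 →
        ∃ R ∈ AWGNMAC.rateRegion P₁ P₂ N K, dist R (AWGNMAC.ozarowCorner P₁ P₂ N) < ε) :=
  ⟨AWGNMAC.ozarowRegion_subset_closure hP₁ hP₂ hN,
    ⟨AWGNMAC.ozarowCorner_mem_capacity hP₁ hP₂ hN,
      fun _ hR hne => AWGNMAC.sumRate_lt_of_ne_ozarowCorner hP₁ hP₂ hN hR hne⟩,
    fun _ hε => AWGNMAC.exists_mem_rateRegion_dist_ozarowCorner_lt hP₁ hP₂ hN hε⟩
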